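/- Let $\Bbbk$ be a field and let $n\ge 6$. Let $\mathcal H_n$ be the simple graph with vertices $x_1,\dots,x_n$ and edge set $$\{x_ix_{i+1}: 1\le i\le n-5\}\cup\{x_{n-4}x_{n-2},\,x_{n-2}x_{n-3}\}\cup\{x_{n-1}x_j: j\in[n]\setminus\{1,n-1\}\}\cup\{x_nx_j: j\in[n]\setminus\{n-3,n\}\},$$ and let $\mathcal H_n^c$ be its complement. Let $I\subseteq S=\Bbbk[x_1,\dots,x_n]$ be the edge ideal of $\mathcal H_n^c$, i.e. the ideal generated by the products $x_ix_j$ over the edges $x_ix_j$ of $\mathcal H_n^c$. For $k\ge 0$ let $\mathrm{HS}_k(\mathcal H_n^c)$ be the $k$-th homological shift ideal of $I$: if $\cdots\to F_1\to F_0\to 0$ is the minimal $\mathbb N^n$-graded free resolution of $I$ over $S$ and $F_k=\bigoplus_{j=1}^{b_k}S(-\mathbf a_{kj})$, then $\mathrm{HS}_k(\mathcal H_n^c)$ is generated by the monomials $\mathbf x^{\mathbf a_{kj}}$, $j=1,\dots,b_k$. A monomial ideal has linear quotients if its minimal monomial generators can be ordered as $m_1,\dots,m_q$ so that for each $1\le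 i\le q-1$ the ideal $(m_1,\dots,m_i):m_{i+1}$ is generated by a set of variables. Then: (i) for every integer $k$ with $2\le k<n-4$, $\mathrm{HS}_k(\mathcal H_n^c)\ne 0$ and $\mathrm{HS}_k(\mathcal H_n^c)$ has linear quotients; (ii) $\mathrm{HS}_{n-4}(\mathcal H_n^c)\neq 0$ and $\mathrm{HS}_{n-4}(\mathcal H_n^c)$ does not have linear quotients; (iii) $\mathrm{HS}_k(\mathcal H_n^c)=0$ for every integer $k>n-4$. -/

import Mathlib

open MvPolynomial

namespace HomShift

/-- The edge ideal of a simple graph `G`: the ideal generated by `x_u x_v` over the edges `uv`. -/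
noncomputable def edgeIdeal (𝕜 : Type*) [Field 𝕜] {V : Type*} (G : SimpleGraph V) :
    Ideal (MvPolynomial V 𝕜) :=
  Ideal.span {f | ∃ u v, G.Adj u v ∧ f = X u * X v}

/-- A minimal multigraded free resolution
`⋯ → F_2 → F_1 → F_0 → 0` of a (monomial) ideal `I` of a polynomial ring `S = 𝕜[x_v : v ∈ σ]`,
where `F_i = ⨁_j S(-a_{ij})` has finite rank.
The differential `F_{i+1} → F_i` is given by its matrix in the standard homogeneous bases, and
the identification `H_0(F) ≅ I` by the induced surjection `F_0 → I`, the basis element `e_j` being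
sent to `aug j`. -/
structure MinimalResolution {𝕜 : Type*} [Field 𝕜] {σ : Type*} (I : Ideal (MvPolynomial σ 𝕜)) where
  /-- the rank of `F_i` -/
  rank : ℕ → ℕ
  /-- the multidegree `a_{ij}` of the `j`-th basis element of `F_i` -/
  shift : (i : ℕ) → Fin (rank i) → (σ →₀ ℕ)
  /-- the matrix of `F_{i+1} → F_i` -/
  diff : (i : ℕ) → Matrix (Fin (rank i)) (Fin (rank (i + 1))) (MvPolynomial σ 𝕜)
  /-- the images in `I` of the basis elements of `F_0` -/
  aug : Fin (rank 0) → MvPolynomial σ 𝕜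
  /-- the differentials preserve multidegrees -/
  diff_homogeneous : ∀ i p q, ∀ s ∈ (diff i p q).support, s + shift i p = shift (i + 1) q
  /-- the map `F_0 → I` preserves multidegrees -/
  aug_homogeneous : ∀ q, ∀ s ∈ (aug q).support, s = shift 0 q
  /-- the image of `F_0` is `I` -/
  range_aug : Ideal.span (Set.range aug) = I
  /-- exactness at `F_0` -/
  exact_zero : Function.Exact (diff 0).mulVecLin (Fintype.linearCombination (MvPolynomial σ 𝕜) aug)
  /-- exactness at `F_{i+1}` -/
  exact_succ : ∀ i, Function.Exact (diff (i + 1)).mulVecLin (diff i).mulVecLin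
  /-- minimality: the image of `F_{i+1}` lies in `(x_v : v ∈ σ) F_i` -/
  minimal : ∀ i p q, diff i p q ∈ Ideal.span (Set.range (X : σ → MvPolynomial σ 𝕜))

/-- The `k`-th homological shift ideal of a monomial ideal `I`: it is generated by the monomials
`x^a`, where `a` runs over the multigraded shifts of the `k`-th module of the minimal multigraded
free resolution of `I` (which is unique up to isomorphism). -/
noncomputable def HS {𝕜 : Type*} [Field 𝕜] {σ : Type*} (k : ℕ) (I : Ideal (MvPolynomial σ 𝕜)) :
    Ideal (MvPolynomial σ 𝕜) :=
  Ideal.span {f | ∃ (F : MinimalResolution I) (j : Fin (F.rank k)), f = monomial (F.shift k j) 1}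

/-- The (exponents of the) minimal monomial generators of a monomial ideal `I`: the monomials of `I`
that are minimal with respect to divisibility. -/
def minGens {𝕜 : Type*} [Field 𝕜] {σ : Type*} (I : Ideal (MvPolynomial σ 𝕜)) : Set (σ →₀ ℕ) :=
  {a | Minimal (fun b => (monomial b (1 : 𝕜)) ∈ I) a}

/-- `I` has linear quotients: its minimal monomial generators can be listed, without repetition,
as `m_0, …, m_{q-1}` such that each colon ideal `(m_0, …, m_{i-1}) : m_i` with `0 < i` is generated
by a set of variables. -/
def HasLinearQuotients {𝕜 : Type*} [Field 𝕜] {σ : Type*} (I : Ideal (MvPolynomial σ 𝕜)) : Prop :=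
  ∃ (q : ℕ) (m : Fin q → (σ →₀ ℕ)), Function.Injective m ∧ Set.range m = minGens I ∧
    ∀ i : Fin q, 0 < (i : ℕ) → ∃ T : Set σ,
      (Ideal.span {f | ∃ j, j < i ∧ f = monomial (m j) (1 : 𝕜)}).colon {monomial (m i) (1 : 𝕜)} =
        Ideal.span ((X : σ → MvPolynomial σ 𝕜) '' T)

/-- The graph `H_n` (for `n ≥ 6`) on the vertices `x_1, …, x_n`; the vertex `x_i` is the element
`i - 1` of `Fin n`. Its edges are `x_i x_{i+1}` for `1 ≤ i ≤ n - 5`, `x_{n-4} x_{n-2}`,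
`x_{n-2} x_{n-3}`, `x_{n-1} x_j` for `j ∉ {1, n - 1}` and `x_n x_j` for `j ∉ {n - 3, n}`. -/
def graphH (n : ℕ) : SimpleGraph (Fin n) :=
  SimpleGraph.fromRel fun u v =>
    let i := (u : ℕ) + 1
    let j := (v : ℕ) + 1
    (i ≤ n - 5 ∧ j = i + 1) ∨ (i = n - 4 ∧ j = n - 2) ∨ (i = n - 2 ∧ j = n - 3) ∨
      (i = n - 1 ∧ j ≠ 1) ∨ (i = n ∧ j ≠ n - 3)

end HomShift

/-! The graph `graphH n` is chordal, so the edge ideal of its complement has a linear resolution.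
Inserting the vertices against a perfect elimination ordering, each new vertex `v` replaces the
ideal `J` by `J + x_v P`, where `P` is generated by the variables of the non-neighbours of `v`, and
a mapping cone resolves the new ideal (`HasLinearResolution.sup_mul`). The cone is minimal for
degree reasons, and its shifts can be followed: in homological degree `k` they are the squarefree
monomials `x^W` with `|W| = k + 2` and `W` inducing a disconnected subgraph (`HS_edgeIdeal_compl`).
Comparison of resolutions shows that every minimal resolution has the same shifts, so these
monomials generate `HS k`.

What remains is combinatorial. After relabelling, the graph is a path `2, …, n - 1` with two
adjacent apexes, `0` missing only `2` and `1` missing only `n - 1`. Its disconnected vertex sets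
(`IsCut`) have at most `n - 2` elements, and that size occurs only for the complements of `{1, 3}`
and `{0, n - 2}`. Neither complement lies in the other with one vertex added, so the two generators
of `HS (n - 4)` have no linear quotients. Below the top size, listing the sets in decreasing
colexicographic order gives linear quotients, by `IsCut.exists_exchange`. -/

namespace HomShift

/-! ### Multigraded matrices and their graded components. -/

section Homogeneous

variable {𝕜 : Type*} [Field 𝕜] {σ : Type*}

/-- The part of `f` of multidegree `a`, where `f` is an element of `S(-t)`. -/
noncomputable def component (t a : σ →₀ ℕ) (f : MvPolynomial σ 𝕜) : MvPolynomial σ 𝕜 :=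
  open Classical in ∑ s ∈ f.support with s + t = a, monomial s (coeff s f)

open Classical in
theorem coeff_component (t a r : σ →₀ ℕ) (f : MvPolynomial σ 𝕜) :
    coeff r (component t a f) = if r + t = a then coeff r f else 0 := by
  unfold component
  simp only [coeff_sum, coeff_monomial, Finset.sum_ite_eq', Finset.mem_filter, mem_support_iff]
  split_ifs <;> simp_all

theorem component_eq_self {t a : σ →₀ ℕ} {f : MvPolynomial σ 𝕜}
    (h : ∀ s ∈ f.support, s + t = a) : component t a f = f := by
  ext r
  rw [coeff_component]
  split_ifs with hr
  · rfl
  · by_contra h0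
    exact hr (h r (mem_support_iff.2 (Ne.symm h0)))

theorem component_mul {t u a : σ →₀ ℕ} {m : MvPolynomial σ 𝕜}
    (h : ∀ s ∈ m.support, s + t = u) (f : MvPolynomial σ 𝕜) :
    component t a (m * f) = m * component u a f := by
  classical
  ext r
  rw [coeff_component, coeff_mul, coeff_mul,
    ← Finset.sum_const_zero (s := Finset.HasAntidiagonal.antidiagonal r), ← Finset.sum_ite_irrel]
  refine Finset.sum_congr rfl ?_
  rintro ⟨x, y⟩ hxy
  replace hxy := Finset.HasAntidiagonal.mem_antidiagonal.1 hxy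
  by_cases hx : coeff x m = 0
  · simp [hx]
  have := h x (mem_support_iff.2 hx)
  have e : r + t = y + u := by rw [← hxy, ← this]; abel
  simp only [coeff_component, e]
  split_ifs <;> simp

theorem component_sum {ι : Type*} (t a : σ →₀ ℕ) (s : Finset ι) (f : ι → MvPolynomial σ 𝕜) :
    component t a (∑ i ∈ s, f i) = ∑ i ∈ s, component t a (f i) := by
  classical
  ext r
  simp only [coeff_component, coeff_sum]
  split_ifs <;> simp

/-- The matrix `M` defines a multigraded map `⨁_q S(-u_q) → ⨁_p S(-t_p)`. -/
def IsHomog {ι κ : Type*} (t : ι → (σ →₀ ℕ)) (u : κ → (σ →₀ ℕ))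
    (M : Matrix ι κ (MvPolynomial σ 𝕜)) : Prop :=
  ∀ p q, ∀ s ∈ (M p q).support, s + t p = u q

/-- Replacing each entry of a solution by its component of the required multidegree preserves the
product, because multiplication by a homogeneous entry commutes with taking components. -/
theorem IsHomog.exists_mul_eq {ι κ μ : Type*} [Fintype κ] {t : ι → (σ →₀ ℕ)}
    {u : κ → (σ →₀ ℕ)} {w : μ → (σ →₀ ℕ)} {A : Matrix ι κ (MvPolynomial σ 𝕜)}
    {M : Matrix ι μ (MvPolynomial σ 𝕜)} (hA : IsHomog t u A) (hM : IsHomog t w M)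
    (h : ∃ N : Matrix κ μ (MvPolynomial σ 𝕜), A * N = M) :
    ∃ N : Matrix κ μ (MvPolynomial σ 𝕜), IsHomog u w N ∧ A * N = M := by
  classical
  obtain ⟨N, rfl⟩ := h
  refine ⟨Matrix.of fun p q => component (u p) (w q) (N p q), ?_, ?_⟩
  · intro p q s hs
    rw [mem_support_iff, Matrix.of_apply, coeff_component] at hs
    by_contra h
    simp [h] at hs
  · ext1 p q
    rw [← component_eq_self (hM p q), Matrix.mul_apply, Matrix.mul_apply, component_sum]
    exact Finset.sum_congr rfl fun x _ => (component_mul (hA p x) _).symm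

theorem IsHomog.mul {ι κ μ : Type*} [Fintype κ] {t : ι → (σ →₀ ℕ)}
    {u : κ → (σ →₀ ℕ)} {w : μ → (σ →₀ ℕ)} {A : Matrix ι κ (MvPolynomial σ 𝕜)}
    {B : Matrix κ μ (MvPolynomial σ 𝕜)} (hA : IsHomog t u A) (hB : IsHomog u w B) :
    IsHomog t w (A * B) := by
  classical
  intro p q s hs
  rw [Matrix.mul_apply] at hs
  obtain ⟨x, -, hx⟩ := Finset.mem_biUnion.1 (support_sum hs)
  obtain ⟨y, hy, z, hz, rfl⟩ := Finset.mem_add.1 (support_mul _ _ hx)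
  rw [← hB x q z hz, ← hA p x y hy]
  abel

end Homogeneous

theorem exists_mul_eq_of_exact {R ι κ μ ν : Type*} [CommRing R] [Fintype ι] [Fintype κ]
    {A : Matrix ι κ R} {B : Matrix ν ι R} (h : Function.Exact A.mulVecLin B.mulVecLin)
    {M : Matrix ι μ R} (hM : B * M = 0) : ∃ N : Matrix κ μ R, A * N = M := by
  have : ∀ q, ∃ v, A.mulVecLin v = M.col q := fun q => by
    apply (h _).1
    ext p
    exact congrFun (congrFun hM p) q
  choose N hN using this
  refine ⟨Matrix.of fun p q => N q p, ?_⟩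
  ext p q
  exact congrFun (hN q) p

theorem mul_eq_zero_of_exact {R ι κ ν : Type*} [CommRing R] [Fintype ι] [Fintype κ]
    {A : Matrix ι κ R} {B : Matrix ν ι R} (h : Function.Exact A.mulVecLin B.mulVecLin) :
    B * A = 0 := by
  classical
  apply Matrix.ext_of_mulVec_single
  intro i
  rw [← Matrix.mulVec_mulVec, Matrix.zero_mulVec]
  exact h.apply_apply_eq_zero _

/-! ### Comparison of resolutions and uniqueness of the shifts. -/

namespace MinimalResolution

variable {𝕜 : Type*} [Field 𝕜] {σ : Type*} {I P : Ideal (MvPolynomial σ 𝕜)}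

/-- The augmentation, as a matrix with one row. -/
def augMatrix (F : MinimalResolution I) : Matrix (Fin 1) (Fin (F.rank 0)) (MvPolynomial σ 𝕜) :=
  Matrix.of fun _ => F.aug

/-- Writing the augmentation as a matrix lets homological degree zero be handled by the same lifting
lemmas as the differentials. -/
theorem augMatrix_mulVec (F : MinimalResolution I) (v : Fin (F.rank 0) → MvPolynomial σ 𝕜)
    (p : Fin 1) :
    F.augMatrix.mulVec v p = Fintype.linearCombination (MvPolynomial σ 𝕜) F.aug v := by
  simp [augMatrix, Matrix.mulVec, dotProduct, Fintype.linearCombination_apply, mul_comm]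

theorem isHomog_augMatrix (F : MinimalResolution I) :
    IsHomog (fun _ => 0) (F.shift 0) F.augMatrix :=
  fun _ q s hs => (add_zero s).trans (F.aug_homogeneous q s hs)

theorem exact_augMatrix (F : MinimalResolution I) :
    Function.Exact (F.diff 0).mulVecLin F.augMatrix.mulVecLin := by
  intro v
  rw [← F.exact_zero v]
  constructor
  · intro h
    rw [← F.augMatrix_mulVec v 0]
    exact congrFun h 0
  · intro h
    ext1 p
    exact (F.augMatrix_mulVec v p).trans h

theorem augMatrix_mul_diff (F : MinimalResolution I) : F.augMatrix * F.diff 0 = 0 :=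
  mul_eq_zero_of_exact F.exact_augMatrix

theorem diff_mul_diff (F : MinimalResolution I) (k : ℕ) : F.diff k * F.diff (k + 1) = 0 :=
  mul_eq_zero_of_exact (F.exact_succ k)

theorem exists_lift_zero (F : MinimalResolution I) (G : MinimalResolution P) (h : I ≤ P) :
    ∃ α : Matrix (Fin (G.rank 0)) (Fin (F.rank 0)) (MvPolynomial σ 𝕜),
      IsHomog (G.shift 0) (F.shift 0) α ∧ G.augMatrix * α = F.augMatrix := by
  apply G.isHomog_augMatrix.exists_mul_eq F.isHomog_augMatrix
  have : ∀ q, ∃ c : Fin (G.rank 0) → MvPolynomial σ 𝕜, ∑ i, c i * G.aug i = F.aug q := fun q => by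
    apply Ideal.mem_span_range_iff_exists_fun.1
    have := h (F.range_aug.le (Ideal.subset_span ⟨q, rfl⟩))
    exact G.range_aug.ge this
  choose c hc using this
  refine ⟨Matrix.of fun p q => c q p, ?_⟩
  ext1 p q
  rw [Matrix.mul_apply]
  exact (Finset.sum_congr rfl fun i _ => mul_comm _ _).trans (hc q)

/-- The inclusion of ideals lifts to a multigraded chain map of resolutions. -/
theorem exists_lift (F : MinimalResolution I) (G : MinimalResolution P) (h : I ≤ P) :
    ∃ α : ∀ k, Matrix (Fin (G.rank k)) (Fin (F.rank k)) (MvPolynomial σ 𝕜),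
      (∀ k, IsHomog (G.shift k) (F.shift k) (α k)) ∧ G.augMatrix * α 0 = F.augMatrix ∧
      ∀ k, G.diff k * α (k + 1) = α k * F.diff k := by
  -- Each component of the lift is bundled with the solvability of the next lifting problem, which
  -- is what the recursion needs.
  let T : ℕ → Type _ := fun k =>
    {α : Matrix (Fin (G.rank k)) (Fin (F.rank k)) (MvPolynomial σ 𝕜) //
      IsHomog (G.shift k) (F.shift k) α ∧
        ∃ β : Matrix (Fin (G.rank (k + 1))) (Fin (F.rank (k + 1))) (MvPolynomial σ 𝕜),
          G.diff k * β = α * F.diff k}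
  obtain ⟨α₀, hα₀, e₀⟩ := exists_lift_zero F G h
  let init : T 0 := ⟨α₀, hα₀, exists_mul_eq_of_exact G.exact_augMatrix
    (by rw [← Matrix.mul_assoc, e₀, F.augMatrix_mul_diff])⟩
  have step : ∀ k (α : T k), ∃ β : T (k + 1), G.diff k * β.1 = α.1 * F.diff k := by
    rintro k ⟨α, hα, h⟩
    obtain ⟨β, hβ, e⟩ :=
      IsHomog.exists_mul_eq (G.diff_homogeneous k) (hα.mul (F.diff_homogeneous k)) h
    refine ⟨⟨β, hβ, exists_mul_eq_of_exact (G.exact_succ k) ?_⟩, e⟩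
    rw [← Matrix.mul_assoc, e, Matrix.mul_assoc, F.diff_mul_diff, Matrix.mul_zero]
  choose next hnext using step
  let α : ∀ k, T k := fun k => Nat.rec init next k
  exact ⟨fun k => (α k).1, fun k => (α k).2.1, e₀, fun k => hnext k (α k)⟩

/-- A chain endomorphism that lifts zero vanishes modulo the variables. -/
theorem mem_of_lift_zero (F : MinimalResolution I)
    (φ : ∀ k, Matrix (Fin (F.rank k)) (Fin (F.rank k)) (MvPolynomial σ 𝕜))
    (h₀ : F.augMatrix * φ 0 = 0) (h : ∀ k, F.diff k * φ (k + 1) = φ k * F.diff k) (k : ℕ)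
    (p q : Fin (F.rank k)) :
    φ k p q ∈ Ideal.span (Set.range (X : σ → MvPolynomial σ 𝕜)) := by
  -- Only one component `s` of a null homotopy is carried along. The first equation is the homotopy
  -- identity composed with `F.diff k`, so the previous component does not appear in it.
  suffices H : ∃ s : Matrix (Fin (F.rank (k + 1))) (Fin (F.rank k)) (MvPolynomial σ 𝕜),
      F.diff k * s * F.diff k = φ k * F.diff k ∧
      ∀ p q, φ k p q ∈ Ideal.span (Set.range (X : σ → MvPolynomial σ 𝕜)) by
    obtain ⟨_, _, H⟩ := H
    exact H p q
  clear p q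
  induction k with
  | zero =>
    obtain ⟨s, hs⟩ := exists_mul_eq_of_exact F.exact_augMatrix h₀
    refine ⟨s, by rw [hs], fun p q => ?_⟩
    rw [← hs, Matrix.mul_apply]
    exact sum_mem fun i _ => Ideal.mul_mem_right _ _ (F.minimal 0 p i)
  | succ k ih =>
    obtain ⟨s, hs, -⟩ := ih
    have : F.diff k * (φ (k + 1) - s * F.diff k) = 0 := by
      rw [Matrix.mul_sub, h, ← Matrix.mul_assoc, hs, sub_self]
    obtain ⟨s', hs'⟩ := exists_mul_eq_of_exact (F.exact_succ k) this
    refine ⟨s', ?_, fun p q => ?_⟩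
    · rw [hs', Matrix.sub_mul, Matrix.mul_assoc s, F.diff_mul_diff, Matrix.mul_zero, sub_zero]
    · rw [show φ (k + 1) = s * F.diff k + F.diff (k + 1) * s' by rw [hs']; abel, Matrix.add_apply,
        Matrix.mul_apply, Matrix.mul_apply]
      exact add_mem (sum_mem fun i _ => Ideal.mul_mem_left _ _ (F.minimal k i q))
        (sum_mem fun i _ => Ideal.mul_mem_right _ _ (F.minimal (k + 1) p i))

/-- Any two minimal resolutions have the same shifts. -/
theorem range_shift_subset (F G : MinimalResolution I) (k : ℕ) :
    Set.range (F.shift k) ⊆ Set.range (G.shift k) := by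
  classical
  rintro _ ⟨j, rfl⟩
  obtain ⟨f, hf, f₀, f₁⟩ := F.exists_lift G le_rfl
  obtain ⟨g, -, g₀, g₁⟩ := G.exists_lift F le_rfl
  -- Both `g * f` and the identity lift the identity of `I`, so their difference vanishes modulo the
  -- variables and `(g * f) j j` has constant term `1`.
  have := F.mem_of_lift_zero (fun k => 1 - g k * f k)
    (by rw [Matrix.mul_sub, ← Matrix.mul_assoc, g₀, f₀, Matrix.mul_one, sub_self])
    (fun k => by
      rw [Matrix.mul_sub, Matrix.sub_mul, ← Matrix.mul_assoc, g₁, Matrix.mul_assoc, f₁]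
      simp [Matrix.mul_assoc]) k j j
  have hc : constantCoeff (∑ p, g k j p * f k p j) = 1 := by
    rw [← Matrix.mul_apply]
    have h0 : constantCoeff (((1 - g k * f k : Matrix _ _ _) j j)) = 0 := by
      have hle : Ideal.span (Set.range (X : σ → MvPolynomial σ 𝕜)) ≤
          RingHom.ker (constantCoeff (R := 𝕜) (σ := σ)) := by
        rw [Ideal.span_le]
        rintro _ ⟨v, rfl⟩
        simp [RingHom.mem_ker]
      exact hle this
    rw [Matrix.sub_apply, Matrix.one_apply_eq, map_sub, map_one, sub_eq_zero] at h0
    exact h0.symm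
  rw [map_sum] at hc
  obtain ⟨p, -, hp⟩ := Finset.exists_ne_zero_of_sum_ne_zero (hc.trans_ne one_ne_zero)
  rw [map_mul] at hp
  refine ⟨p, ?_⟩
  -- A nonzero constant term in a homogeneous entry forces the two shifts to coincide.
  have := hf k p j 0 (mem_support_iff.2 (right_ne_zero_of_mul hp))
  rwa [zero_add] at this

/-- The definition of `HS` lets the resolution vary; as the set of shifts does not depend on it, a
single resolution suffices. -/
theorem HS_eq (F : MinimalResolution I) (k : ℕ) :
    HS k I = Ideal.span ((fun a => monomial a (1 : 𝕜)) '' Set.range (F.shift k)) := by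
  unfold HS
  congr 1
  ext f
  constructor
  · rintro ⟨G, j, rfl⟩
    exact ⟨_, G.range_shift_subset F k ⟨j, rfl⟩, rfl⟩
  · rintro ⟨_, ⟨j, rfl⟩, rfl⟩
    exact ⟨F, j, rfl⟩

end MinimalResolution

/-! ### Reindexing of bases, and the resolutions of the zero and unit ideals. -/

theorem exact_submatrix {R ι κ ν ι' κ' ν' : Type*} [CommRing R] [Fintype ι] [Fintype κ]
    [Fintype ι'] [Fintype κ']
    {A : Matrix ι κ R} {B : Matrix ν ι R} (h : Function.Exact A.mulVecLin B.mulVecLin)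
    (e : ι' ≃ ι) (f : κ' ≃ κ) (g : ν' ≃ ν) :
    Function.Exact (A.submatrix e f).mulVecLin (B.submatrix g e).mulVecLin := by
  intro v
  have h1 := h (v ∘ e.symm)
  simp only [Matrix.mulVecLin_apply, Set.mem_range] at h1 ⊢
  rw [Matrix.submatrix_mulVec_equiv]
  have : (B.mulVec (v ∘ e.symm)) ∘ g = 0 ↔ B.mulVec (v ∘ e.symm) = 0 := by
    constructor
    · intro h
      ext i
      simpa using congrFun h (g.symm i)
    · intro h
      rw [h]
      rfl
  rw [this, h1]
  constructor
  · rintro ⟨w, hw⟩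
    refine ⟨w ∘ f, ?_⟩
    rw [Matrix.submatrix_mulVec_equiv]
    ext i
    simp [Function.comp_assoc, hw]
  · rintro ⟨w, rfl⟩
    refine ⟨w ∘ f.symm, ?_⟩
    rw [Matrix.submatrix_mulVec_equiv]
    ext i
    simp

section

variable {𝕜 : Type*} [Field 𝕜] {σ : Type*}

/-- A minimal resolution may be given with arbitrary finite index types for the bases. -/
theorem exists_minimalResolution {I : Ideal (MvPolynomial σ 𝕜)} (ι : ℕ → Type)
    [∀ k, Fintype (ι k)] (shift : (k : ℕ) → ι k → (σ →₀ ℕ))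
    (diff : (k : ℕ) → Matrix (ι k) (ι (k + 1)) (MvPolynomial σ 𝕜))
    (aug : ι 0 → MvPolynomial σ 𝕜)
    (diff_homog : ∀ k, IsHomog (shift k) (shift (k + 1)) (diff k))
    (aug_homog : ∀ q, ∀ s ∈ (aug q).support, s = shift 0 q)
    (range_aug : Ideal.span (Set.range aug) = I)
    (exact_zero : Function.Exact (diff 0).mulVecLin
      (Fintype.linearCombination (MvPolynomial σ 𝕜) aug))
    (exact_succ : ∀ k, Function.Exact (diff (k + 1)).mulVecLin (diff k).mulVecLin)
    (minimal : ∀ k p q, diff k p q ∈ Ideal.span (Set.range (X : σ → MvPolynomial σ 𝕜))) :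
    ∃ F : MinimalResolution I, ∀ k, Set.range (F.shift k) = Set.range (shift k) := by
  let e : ∀ k, Fin (Fintype.card (ι k)) ≃ ι k := fun k => (Fintype.equivFin (ι k)).symm
  refine ⟨{ rank := fun k => Fintype.card (ι k)
            shift := fun k j => shift k (e k j)
            diff := fun k => (diff k).submatrix (e k) (e (k + 1))
            aug := fun j => aug (e 0 j)
            diff_homogeneous := fun k p q => diff_homog k _ _
            aug_homogeneous := fun q => aug_homog _
            range_aug := ?_
            exact_zero := ?_
            exact_succ := fun k => exact_submatrix (exact_succ k) _ _ _
            minimal := fun k p q => minimal k _ _ }, fun k => (e k).surjective.range_comp _⟩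
  · rw [← range_aug]
    exact congrArg _ ((e 0).surjective.range_comp aug)
  · intro v
    have h1 := exact_zero (v ∘ (e 0).symm)
    have h2 : Fintype.linearCombination (MvPolynomial σ 𝕜) (fun j => aug (e 0 j)) v =
        Fintype.linearCombination (MvPolynomial σ 𝕜) aug (v ∘ (e 0).symm) := by
      rw [Fintype.linearCombination_apply, Fintype.linearCombination_apply]
      exact Fintype.sum_equiv (e 0) _ _ fun x => by simp
    rw [h2, h1]
    simp only [Matrix.mulVecLin_apply, Set.mem_range]
    constructor
    · rintro ⟨w, hw⟩
      refine ⟨w ∘ e 1, ?_⟩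
      rw [Matrix.submatrix_mulVec_equiv]
      ext i
      simp [Function.comp_assoc, hw]
    · rintro ⟨w, rfl⟩
      refine ⟨w ∘ (e 1).symm, ?_⟩
      rw [Matrix.submatrix_mulVec_equiv]
      ext i
      simp

/-- `I` has a `d`-linear minimal resolution whose multigraded shifts in homological degree `k`
form the set `D k`. -/
def HasLinearResolution (d : ℕ) (I : Ideal (MvPolynomial σ 𝕜)) (D : ℕ → Set (σ →₀ ℕ)) : Prop :=
  ∃ F : MinimalResolution I, (∀ k, Set.range (F.shift k) = D k) ∧
    ∀ k j, (F.shift k j).degree = d + k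

theorem hasLinearResolution_bot (d : ℕ) :
    HasLinearResolution d (⊥ : Ideal (MvPolynomial σ 𝕜)) fun _ => ∅ := by
  refine ⟨{ rank := fun _ => 0
            shift := fun _ => Fin.elim0
            diff := fun _ => 0
            aug := Fin.elim0
            diff_homogeneous := fun _ p => p.elim0
            aug_homogeneous := fun p => p.elim0
            range_aug := by simp
            exact_zero := ?_
            exact_succ := ?_
            minimal := fun _ p => p.elim0 }, by simp, fun _ p => p.elim0⟩
  · intro v
    rw [Subsingleton.elim v 0]
    exact iff_of_true (map_zero _) ⟨0, map_zero _⟩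
  · intro k v
    rw [Subsingleton.elim v 0]
    exact iff_of_true (map_zero _) ⟨0, map_zero _⟩

theorem hasLinearResolution_top :
    HasLinearResolution 0 (⊤ : Ideal (MvPolynomial σ 𝕜)) fun k => {a | k = 0 ∧ a = 0} := by
  obtain ⟨F, hF⟩ := exists_minimalResolution (I := (⊤ : Ideal (MvPolynomial σ 𝕜)))
    -- This index type has one element for `k = 0` and is empty otherwise: the resolution is `S`
    -- itself.
    (fun k => {_u : Unit // k = 0}) (fun _ _ => 0) (fun _ => 0) (fun _ => 1)
    (fun k p q s hs => by simp at hs)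
    (fun q s hs => by simpa using hs)
    (by
      have : Nonempty {_u : Unit // 0 = 0} := ⟨⟨(), rfl⟩⟩
      rw [Set.range_const, Ideal.span_singleton_one])
    (fun v => by
      have : Unique {_u : Unit // 0 = 0} := ⟨⟨⟨(), rfl⟩⟩, fun _ => rfl⟩
      have : IsEmpty {_u : Unit // 0 + 1 = 0} := ⟨fun u => by simpa using u.2⟩
      rw [Fintype.linearCombination_apply, Fintype.sum_unique, smul_eq_mul, mul_one]
      constructor
      · intro h
        refine ⟨0, ?_⟩
        ext1 i
        rw [Subsingleton.elim i default, h, map_zero, Pi.zero_apply]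
      · rintro ⟨w, rfl⟩
        rw [Subsingleton.elim w 0, map_zero, Pi.zero_apply])
    (fun k v => by
      have : IsEmpty {_u : Unit // k + 1 = 0} := ⟨fun u => by simpa using u.2⟩
      rw [Subsingleton.elim v 0]
      exact iff_of_true (map_zero _) ⟨0, map_zero _⟩)
    (fun k p q => by simp)
  have hD : ∀ k, Set.range (F.shift k) = {a | k = 0 ∧ a = 0} := by
    intro k
    rw [hF]
    ext a
    rcases k with _ | k
    · simp
    · simp
  refine ⟨F, hD, fun k j => ?_⟩
  obtain ⟨rfl, h⟩ : k = 0 ∧ F.shift k j = 0 := (hD k).le ⟨j, rfl⟩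
  rw [h, map_zero]
  rfl

end

/-! ### Mapping cones: a resolution of `J + x_v P`. -/

section

variable {𝕜 : Type*} [Field 𝕜] {σ : Type*}

/-- A nonzero constant term would force equal multidegrees. This yields the minimality of the cone.
-/
theorem IsHomog.mem_span_X {ι κ : Type*} {t : ι → (σ →₀ ℕ)} {u : κ → (σ →₀ ℕ)}
    {M : Matrix ι κ (MvPolynomial σ 𝕜)} (hM : IsHomog t u M) {p : ι} {q : κ}
    (h : (t p).degree < (u q).degree) :
    M p q ∈ Ideal.span (Set.range (X : σ → MvPolynomial σ 𝕜)) := by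
  rw [← Set.image_univ, mem_ideal_span_X_image]
  intro s hs
  by_contra! h0
  have : s = 0 := Finsupp.ext fun i => h0 i (Set.mem_univ i)
  have := hM p q s hs
  simp_all

section ConeMatrix

variable {ι₀ ι₁ ι₂ κ₀ κ₁ κ₂ μ : Type*} [DecidableEq ι₀]

/-- The differential of the mapping cone of `F(-v) → F ⊕ G(-v)`, where `D` and `D'` are consecutive
differentials of `F`, `E` is a differential of `G`, and `A` is a component of `F → G`. -/
noncomputable def coneMatrix (v : σ) (D : Matrix ι₀ ι₁ (MvPolynomial σ 𝕜))
    (E : Matrix κ₀ κ₁ (MvPolynomial σ 𝕜)) (A : Matrix κ₀ ι₀ (MvPolynomial σ 𝕜))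
    (D' : Matrix μ ι₀ (MvPolynomial σ 𝕜)) :
    Matrix (ι₀ ⊕ (κ₀ ⊕ μ)) (ι₁ ⊕ (κ₁ ⊕ ι₀)) (MvPolynomial σ 𝕜) :=
  Matrix.fromBlocks D
    (Matrix.fromCols 0 ((X v : MvPolynomial σ 𝕜) • (1 : Matrix ι₀ ι₀ (MvPolynomial σ 𝕜)))) 0
    (Matrix.fromBlocks E (-A) 0 (-D'))

theorem exists_elim {ι κ μ S : Type*} (w : ι ⊕ (κ ⊕ μ) → S) :
    ∃ a b c, w = Sum.elim a (Sum.elim b c) :=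
  ⟨_, _, _, by rw [Sum.elim_comp_inl_inr, Sum.elim_comp_inl_inr]⟩

theorem elim_eq_zero {ι κ S : Type*} [Zero S] {a : ι → S} {b : κ → S} :
    Sum.elim a b = 0 ↔ a = 0 ∧ b = 0 := by
  rw [← Sum.elim_zero_zero, Sum.elim_eq_iff]

theorem coneMatrix_mulVec [Fintype ι₀] [Fintype ι₁] [Fintype κ₁] (v : σ)
    (D : Matrix ι₀ ι₁ (MvPolynomial σ 𝕜))
    (E : Matrix κ₀ κ₁ (MvPolynomial σ 𝕜)) (A : Matrix κ₀ ι₀ (MvPolynomial σ 𝕜))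
    (D' : Matrix μ ι₀ (MvPolynomial σ 𝕜)) (a : ι₁ → MvPolynomial σ 𝕜)
    (b : κ₁ → MvPolynomial σ 𝕜) (c : ι₀ → MvPolynomial σ 𝕜) :
    (coneMatrix v D E A D').mulVecLin (Sum.elim a (Sum.elim b c)) =
      Sum.elim (D.mulVecLin a + (X v : MvPolynomial σ 𝕜) • c)
        (Sum.elim (E.mulVecLin b - A.mulVecLin c) (-D'.mulVecLin c)) := by
  rw [Matrix.mulVecLin_apply, coneMatrix, Matrix.fromBlocks_mulVec]
  simp only [Sum.elim_comp_inl, Sum.elim_comp_inr]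
  rw [Matrix.fromBlocks_mulVec, Matrix.fromCols_mulVec]
  simp [Matrix.neg_mulVec, Matrix.smul_mulVec, sub_eq_add_neg]

theorem isHomog_coneMatrix {v : σ} {D : Matrix ι₀ ι₁ (MvPolynomial σ 𝕜)}
    {E : Matrix κ₀ κ₁ (MvPolynomial σ 𝕜)} {A : Matrix κ₀ ι₀ (MvPolynomial σ 𝕜)}
    {D' : Matrix μ ι₀ (MvPolynomial σ 𝕜)} {t₀ : ι₀ → (σ →₀ ℕ)} {t₁ : ι₁ → (σ →₀ ℕ)}
    {u₀ : κ₀ → (σ →₀ ℕ)} {u₁ : κ₁ → (σ →₀ ℕ)} {w : μ → (σ →₀ ℕ)} (hD : IsHomog t₀ t₁ D)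
    (hE : IsHomog u₀ u₁ E) (hA : IsHomog u₀ t₀ A) (hD' : IsHomog w t₀ D') :
    IsHomog
      (Sum.elim t₀ (Sum.elim (fun p => u₀ p + Finsupp.single v 1)
        (fun p => w p + Finsupp.single v 1)))
      (Sum.elim t₁ (Sum.elim (fun p => u₁ p + Finsupp.single v 1)
        (fun p => t₀ p + Finsupp.single v 1)))
      (coneMatrix v D E A D') := by
  rintro (p | p | p) (q | q | q) s hs
  · exact hD p q s hs
  · exact absurd (mem_support_iff.1 hs) (by simp [coneMatrix])
  · change s ∈ ((X v : MvPolynomial σ 𝕜) • (1 : Matrix ι₀ ι₀ (MvPolynomial σ 𝕜)) p q).support at hs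
    change s + t₀ p = t₀ q + _
    rw [Matrix.one_apply] at hs
    split_ifs at hs with h
    · subst h
      rw [smul_eq_mul, mul_one, support_X, Finset.mem_singleton] at hs
      rw [hs, add_comm]
    · simp at hs
  · exact absurd (mem_support_iff.1 hs) (by simp [coneMatrix])
  · change s + (u₀ p + _) = u₁ q + _
    rw [← add_assoc, hE p q s hs]
  · change s ∈ (-(A p q)).support at hs
    rw [support_neg] at hs
    change s + (u₀ p + _) = t₀ q + _
    rw [← add_assoc, hA p q s hs]
  · exact absurd (mem_support_iff.1 hs) (by simp [coneMatrix])
  · exact absurd (mem_support_iff.1 hs) (by simp [coneMatrix])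
  · change s ∈ (-(D' p q)).support at hs
    rw [support_neg] at hs
    change s + (w p + _) = t₀ q + _
    rw [← add_assoc, hD' p q s hs]

theorem coneMatrix_mem {v : σ} {D : Matrix ι₀ ι₁ (MvPolynomial σ 𝕜)}
    {E : Matrix κ₀ κ₁ (MvPolynomial σ 𝕜)} {A : Matrix κ₀ ι₀ (MvPolynomial σ 𝕜)}
    {D' : Matrix μ ι₀ (MvPolynomial σ 𝕜)}
    (hD : ∀ p q, D p q ∈ Ideal.span (Set.range (X : σ → MvPolynomial σ 𝕜)))
    (hE : ∀ p q, E p q ∈ Ideal.span (Set.range (X : σ → MvPolynomial σ 𝕜)))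
    (hA : ∀ p q, A p q ∈ Ideal.span (Set.range (X : σ → MvPolynomial σ 𝕜)))
    (hD' : ∀ p q, D' p q ∈ Ideal.span (Set.range (X : σ → MvPolynomial σ 𝕜)))
    (p : ι₀ ⊕ (κ₀ ⊕ μ)) (q : ι₁ ⊕ (κ₁ ⊕ ι₀)) :
    coneMatrix v D E A D' p q ∈ Ideal.span (Set.range (X : σ → MvPolynomial σ 𝕜)) := by
  rcases p with p | p | p <;> rcases q with q | q | q
  · exact hD p q
  · simp [coneMatrix]
  · exact Ideal.mul_mem_right _ _ (Ideal.subset_span ⟨v, rfl⟩)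
  · simp [coneMatrix]
  · exact hE p q
  · exact neg_mem (hA p q)
  · simp [coneMatrix]
  · simp [coneMatrix]
  · exact neg_mem (hD' p q)

/-- Hypothesis `h` makes the last coordinate of a cycle a boundary `D c'`; correcting the other two
coordinates by `x_v c'` and `A₂ c'` turns them into cycles of `F` and `G`. It is stated separately
because in degree zero it comes from the injectivity of `J → P` and in higher degrees from the
exactness of `F`. -/
theorem coneMatrix_exact [Fintype ι₀] [Fintype ι₁] [DecidableEq ι₁] [Fintype ι₂] [Fintype κ₁]
    [Fintype κ₂] (v : σ) {D : Matrix ι₀ ι₁ (MvPolynomial σ 𝕜)}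
    {D₂ : Matrix ι₁ ι₂ (MvPolynomial σ 𝕜)} {E : Matrix κ₀ κ₁ (MvPolynomial σ 𝕜)}
    {E₂ : Matrix κ₁ κ₂ (MvPolynomial σ 𝕜)} {A : Matrix κ₀ ι₀ (MvPolynomial σ 𝕜)}
    {A₂ : Matrix κ₁ ι₁ (MvPolynomial σ 𝕜)} {D' : Matrix μ ι₀ (MvPolynomial σ 𝕜)}
    (hD : Function.Exact D₂.mulVecLin D.mulVecLin) (hE : Function.Exact E₂.mulVecLin E.mulVecLin)
    (hA : E * A₂ = A * D) (hD' : D' * D = 0)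
    (h : ∀ b c, E.mulVecLin b = A.mulVecLin c → D'.mulVecLin c = 0 → ∃ c', D.mulVecLin c' = c) :
    Function.Exact (coneMatrix v D₂ E₂ A₂ D).mulVecLin (coneMatrix v D E A D').mulVecLin := by
  have hA' : ∀ c, E.mulVecLin (A₂.mulVecLin c) = A.mulVecLin (D.mulVecLin c) := fun c => by
    rw [← LinearMap.comp_apply, ← LinearMap.comp_apply, ← Matrix.mulVecLin_mul,
      ← Matrix.mulVecLin_mul, hA]
  have hDD := hD.apply_apply_eq_zero
  have hEE := hE.apply_apply_eq_zero
  intro w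
  obtain ⟨a, b, c, rfl⟩ := exists_elim w
  rw [coneMatrix_mulVec, elim_eq_zero, elim_eq_zero]
  constructor
  · rintro ⟨ha, hb, hc⟩
    obtain ⟨c, rfl⟩ := h b c (sub_eq_zero.1 hb) (neg_eq_zero.1 hc)
    obtain ⟨a', ha'⟩ := (hD (a + (X v : MvPolynomial σ 𝕜) • c)).1 (by rw [map_add, map_smul, ha])
    obtain ⟨b', hb'⟩ := (hE (b - A₂.mulVecLin c)).1 (by rw [map_sub, hA', hb])
    refine ⟨Sum.elim a' (Sum.elim b' (-c)), ?_⟩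
    rw [coneMatrix_mulVec, ha', hb', map_neg, map_neg, smul_neg, neg_neg, sub_neg_eq_add,
      sub_add_cancel, add_neg_cancel_right]
  · rintro ⟨w, hw⟩
    obtain ⟨a', b', c', rfl⟩ := exists_elim w
    rw [coneMatrix_mulVec, Sum.elim_eq_iff, Sum.elim_eq_iff] at hw
    obtain ⟨rfl, rfl, rfl⟩ := hw
    refine ⟨?_, ?_, ?_⟩
    · rw [map_add, hDD, map_smul, zero_add, smul_neg, add_neg_cancel]
    · rw [map_sub, hEE, hA', map_neg, sub_neg_eq_add, zero_sub, neg_add_cancel]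
    · rw [map_neg, neg_neg, ← LinearMap.comp_apply, ← Matrix.mulVecLin_mul, hD',
        Matrix.mulVecLin_zero, LinearMap.zero_apply]

end ConeMatrix

namespace MinimalResolution

variable {J P : Ideal (MvPolynomial σ 𝕜)}

/-- The ranks of the resolution shifted by one step. -/
def prevRank (F : MinimalResolution J) : ℕ → ℕ
  | 0 => 0
  | k + 1 => F.rank k

/-- The multidegrees of the resolution shifted by one step. -/
def prevShift (F : MinimalResolution J) : (k : ℕ) → Fin (F.prevRank k) → (σ →₀ ℕ)
  | 0 => Fin.elim0
  | k + 1 => F.shift k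

/-- The differentials of the resolution shifted by one step. -/
def prevDiff (F : MinimalResolution J) :
    (k : ℕ) → Matrix (Fin (F.prevRank k)) (Fin (F.rank k)) (MvPolynomial σ 𝕜)
  | 0 => Matrix.of Fin.elim0
  | k + 1 => F.diff k

theorem isHomog_prevDiff (F : MinimalResolution J) (k : ℕ) :
    IsHomog (F.prevShift k) (F.shift k) (F.prevDiff k) := by
  cases k with
  | zero => exact fun p => p.elim0
  | succ k => exact F.diff_homogeneous k

theorem prevDiff_mem (F : MinimalResolution J) (k : ℕ) (p : Fin (F.prevRank k))
    (q : Fin (F.rank k)) :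
    F.prevDiff k p q ∈ Ideal.span (Set.range (X : σ → MvPolynomial σ 𝕜)) := by
  cases k with
  | zero => exact p.elim0
  | succ k => exact F.minimal k p q

theorem prevDiff_mul_diff (F : MinimalResolution J) (k : ℕ) : F.prevDiff k * F.diff k = 0 := by
  cases k with
  | zero => exact Matrix.ext fun p => p.elim0
  | succ k => exact F.diff_mul_diff k

/-- The index types of the bases of the mapping cone. -/
abbrev ConeIndex (F : MinimalResolution J) (G : MinimalResolution P) (k : ℕ) : Type :=
  Fin (F.rank k) ⊕ (Fin (G.rank k) ⊕ Fin (F.prevRank k))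

/-- The differential of the mapping cone of `F(-v) → F ⊕ G(-v)`. -/
noncomputable def coneDiff (F : MinimalResolution J) (G : MinimalResolution P) (v : σ)
    (α : ∀ k, Matrix (Fin (G.rank k)) (Fin (F.rank k)) (MvPolynomial σ 𝕜)) (k : ℕ) :
    Matrix (F.ConeIndex G k) (F.ConeIndex G (k + 1)) (MvPolynomial σ 𝕜) :=
  coneMatrix v (F.diff k) (G.diff k) (α k) (F.prevDiff k)

variable {F : MinimalResolution J} {G : MinimalResolution P} {v : σ}
  {α : ∀ k, Matrix (Fin (G.rank k)) (Fin (F.rank k)) (MvPolynomial σ 𝕜)}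

theorem cone_exact_succ (hα : ∀ k, G.diff k * α (k + 1) = α k * F.diff k)
    (h₀ : ∀ b c, (G.diff 0).mulVecLin b = (α 0).mulVecLin c →
      ∃ c', (F.diff 0).mulVecLin c' = c) (k : ℕ) :
    Function.Exact (F.coneDiff G v α (k + 1)).mulVecLin (F.coneDiff G v α k).mulVecLin := by
  refine coneMatrix_exact v (F.exact_succ k) (G.exact_succ k) (hα k) (F.prevDiff_mul_diff k) ?_
  intro b c hb hc
  cases k with
  | zero => exact h₀ b c hb
  | succ k => exact (F.exact_succ k c).1 hc

/-- The augmentation of the mapping cone. -/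
noncomputable def coneAug (F : MinimalResolution J) (G : MinimalResolution P) (v : σ) :
    F.ConeIndex G 0 → MvPolynomial σ 𝕜 :=
  Sum.elim F.aug (Sum.elim (fun p => X v * G.aug p) fun _ => 0)

theorem linearCombination_coneAug (a : Fin (F.rank 0) → MvPolynomial σ 𝕜)
    (b : Fin (G.rank 0) → MvPolynomial σ 𝕜) (c : Fin (F.prevRank 0) → MvPolynomial σ 𝕜) :
    Fintype.linearCombination (MvPolynomial σ 𝕜) (coneAug F G v) (Sum.elim a (Sum.elim b c)) =
      Fintype.linearCombination (MvPolynomial σ 𝕜) F.aug a +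
        X v * Fintype.linearCombination (MvPolynomial σ 𝕜) G.aug b := by
  simp only [Fintype.linearCombination_apply, Fintype.sum_sum_type, coneAug, Sum.elim_inl,
    Sum.elim_inr, smul_eq_mul, mul_zero, Finset.sum_const_zero, add_zero, Finset.mul_sum]
  congr 1
  exact Finset.sum_congr rfl fun i _ => by ring

theorem range_linearCombination_aug (F : MinimalResolution J) {f : MvPolynomial σ 𝕜} :
    f ∈ J ↔ ∃ c, Fintype.linearCombination (MvPolynomial σ 𝕜) F.aug c = f := by
  conv_lhs => rw [← F.range_aug]
  rw [Ideal.mem_span_range_iff_exists_fun]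
  rfl

/-- If `(a, b)` is a relation, `x_v` times the image of `b` lies in `J`, hence so does the image of
`b`. Lifting that image to `F` supplies the remaining coordinate. This is the exactness of `0 →
J(-v) → J ⊕ P(-v) → J + x_v P → 0` in the middle. -/
theorem cone_exact_zero (hα₀ : G.augMatrix * α 0 = F.augMatrix)
    (hv : ∀ f, X v * f ∈ J → f ∈ J) :
    Function.Exact (F.coneDiff G v α 0).mulVecLin
      (Fintype.linearCombination (MvPolynomial σ 𝕜) (coneAug F G v)) := by
  have hα : ∀ c, Fintype.linearCombination (MvPolynomial σ 𝕜) G.aug ((α 0).mulVecLin c) =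
      Fintype.linearCombination (MvPolynomial σ 𝕜) F.aug c := fun c => by
    rw [← G.augMatrix_mulVec _ 0, ← F.augMatrix_mulVec _ 0, ← hα₀, Matrix.mulVecLin_apply,
      Matrix.mulVec_mulVec]
  have hF := F.exact_zero.apply_apply_eq_zero
  have hG := G.exact_zero.apply_apply_eq_zero
  have hc : ∀ a b (c : Fin (F.rank 0) → MvPolynomial σ 𝕜),
      (F.coneDiff G v α 0).mulVecLin (Sum.elim a (Sum.elim b c)) =
        Sum.elim ((F.diff 0).mulVecLin a + (X v : MvPolynomial σ 𝕜) • c)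
          (Sum.elim ((G.diff 0).mulVecLin b - (α 0).mulVecLin c) (-(F.prevDiff 0).mulVecLin c)) :=
    coneMatrix_mulVec v _ _ _ _
  intro w
  obtain ⟨a, b, c, rfl⟩ := exists_elim w
  rw [linearCombination_coneAug]
  constructor
  · intro h
    have hb : Fintype.linearCombination (MvPolynomial σ 𝕜) G.aug b ∈ J := by
      apply hv
      rw [← neg_mem_iff, ← eq_neg_of_add_eq_zero_left h]
      exact F.range_linearCombination_aug.2 ⟨a, rfl⟩
    obtain ⟨c', hc'⟩ := F.range_linearCombination_aug.1 hb
    obtain ⟨a', ha'⟩ := (F.exact_zero (a + X v • c')).1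
      (by rw [map_add, map_smul, hc', smul_eq_mul, h])
    obtain ⟨b', hb'⟩ := (G.exact_zero (b - (α 0).mulVecLin c')).1
      (by rw [map_sub, hα, hc', sub_self])
    refine ⟨Sum.elim a' (Sum.elim b' (-c')), ?_⟩
    refine (hc _ _ _).trans ?_
    rw [ha', hb', map_neg, smul_neg, sub_neg_eq_add, sub_add_cancel,
      add_neg_cancel_right]
    congr 2
    ext1 i
    exact i.elim0
  · rintro ⟨w, hw⟩
    obtain ⟨a', b', c', rfl⟩ :
        ∃ a' b', ∃ c' : Fin (F.rank 0) → MvPolynomial σ 𝕜, w = Sum.elim a' (Sum.elim b' c') :=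
      exists_elim w
    replace hw := (hc _ _ _).symm.trans hw
    rw [Sum.elim_eq_iff, Sum.elim_eq_iff] at hw
    obtain ⟨rfl, rfl, -⟩ := hw
    rw [map_add, map_sub, hF, hG, hα, map_smul, smul_eq_mul]
    ring

theorem span_range_coneAug :
    Ideal.span (Set.range (coneAug F G v)) = J ⊔ Ideal.span {X v} * P := by
  apply le_antisymm
  · rw [Ideal.span_le]
    rintro _ ⟨p | p | p, rfl⟩
    · exact Ideal.mem_sup_left (F.range_aug.le (Ideal.subset_span ⟨p, rfl⟩))
    · exact Ideal.mem_sup_right (Ideal.mul_mem_mul (Ideal.mem_span_singleton_self _)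
        (G.range_aug.le (Ideal.subset_span ⟨p, rfl⟩)))
    · exact zero_mem _
  · refine sup_le ?_ fun f hf => ?_
    · refine F.range_aug.ge.trans (Ideal.span_le.2 ?_)
      rintro _ ⟨p, rfl⟩
      exact Ideal.subset_span ⟨Sum.inl p, rfl⟩
    · obtain ⟨g, hg, rfl⟩ := Ideal.mem_span_singleton_mul.1 hf
      obtain ⟨c, rfl⟩ := G.range_linearCombination_aug.1 hg
      rw [Fintype.linearCombination_apply, Finset.mul_sum]
      refine sum_mem fun p _ => ?_
      rw [smul_eq_mul, mul_left_comm]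
      exact Ideal.mul_mem_left _ _ (Ideal.subset_span ⟨Sum.inr (Sum.inl p), rfl⟩)

end MinimalResolution

open MinimalResolution in
/-- Linear resolutions of `J ⊆ P` yield a linear resolution of `J + x_v P`, if `x_v` is a nonzero
divisor modulo `J`. -/
theorem HasLinearResolution.sup_mul {J P : Ideal (MvPolynomial σ 𝕜)} {d : ℕ}
    {DJ DP : ℕ → Set (σ →₀ ℕ)} (hJ : HasLinearResolution (d + 1) J DJ)
    (hP : HasLinearResolution d P DP) (hle : J ≤ P) (v : σ) (hv : ∀ f, X v * f ∈ J → f ∈ J) :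
    HasLinearResolution (d + 1) (J ⊔ Ideal.span {X v} * P) fun k =>
      {a | a ∈ DJ k ∨ (∃ b ∈ DP k, a = b + Finsupp.single v 1) ∨
        ∃ l, k = l + 1 ∧ ∃ b ∈ DJ l, a = b + Finsupp.single v 1} := by
  obtain ⟨F, hF, hFd⟩ := hJ
  obtain ⟨G, hG, hGd⟩ := hP
  obtain ⟨α, hα, α₀, α₁⟩ := F.exists_lift G hle
  have h₀ : ∀ b c, (G.diff 0).mulVecLin b = (α 0).mulVecLin c →
      ∃ c', (F.diff 0).mulVecLin c' = c := by
    intro b c hb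
    refine (F.exact_augMatrix c).1 ?_
    rw [← α₀, Matrix.mulVecLin_mul, LinearMap.comp_apply, ← hb]
    exact G.exact_augMatrix.apply_apply_eq_zero b
  -- In each homological degree the generators of `F` have total degree one more than those of `G`,
  -- so the comparison map has no units.
  have hαm : ∀ k p q, α k p q ∈ Ideal.span (Set.range (X : σ → MvPolynomial σ 𝕜)) :=
    fun k p q => (hα k).mem_span_X (by rw [hFd, hGd]; omega)
  obtain ⟨C, hC⟩ := exists_minimalResolution (F.ConeIndex G)
    (fun k => Sum.elim (F.shift k) (Sum.elim (fun p => G.shift k p + Finsupp.single v 1)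
      (fun p => F.prevShift k p + Finsupp.single v 1))) (F.coneDiff G v α) (coneAug F G v)
    (fun k => isHomog_coneMatrix (F.diff_homogeneous k) (G.diff_homogeneous k) (hα k)
      (F.isHomog_prevDiff k))
    (by
      rintro (q | q | q) s hs
      · exact F.aug_homogeneous q s hs
      · change s ∈ (X v * G.aug q).support at hs
        rw [support_X_mul, Finset.mem_map] at hs
        obtain ⟨t, ht, rfl⟩ := hs
        rw [G.aug_homogeneous q t ht]
        exact add_comm _ _
      · exact q.elim0)
    span_range_coneAug (cone_exact_zero α₀ hv) (cone_exact_succ α₁ h₀)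
    (fun k => coneMatrix_mem (F.minimal k) (G.minimal k) (hαm k) (F.prevDiff_mem k))
  have hD : ∀ k, Set.range (C.shift k) =
      {a | a ∈ DJ k ∨ (∃ b ∈ DP k, a = b + Finsupp.single v 1) ∨
        ∃ l, k = l + 1 ∧ ∃ b ∈ DJ l, a = b + Finsupp.single v 1} := by
    intro k
    rw [hC, Set.Sum.elim_range, Set.Sum.elim_range]
    ext a
    simp only [Set.mem_union, Set.mem_ofPred_eq, ← hF, ← hG, Set.exists_range_iff]
    refine or_congr Iff.rfl (or_congr (exists_congr fun _ => eq_comm) ?_)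
    cases k with
    | zero =>
      refine iff_of_false ?_ (by simp)
      rintro ⟨p, -⟩
      exact p.elim0
    | succ k =>
      constructor
      · rintro ⟨p, rfl⟩
        exact ⟨k, rfl, p, rfl⟩
      · rintro ⟨l, hl, p, rfl⟩
        obtain rfl : k = l := by omega
        exact ⟨p, rfl⟩
  refine ⟨C, hD, fun k j => ?_⟩
  have : C.shift k j ∈ Set.range (C.shift k) := ⟨j, rfl⟩
  rw [hD] at this
  have hF' : ∀ l, ∀ b ∈ DJ l, b.degree = d + 1 + l := by
    intro l b hb
    rw [← hF] at hb
    obtain ⟨p, rfl⟩ := hb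
    exact hFd l p
  obtain h | ⟨b, hb, h⟩ | ⟨l, rfl, b, hb, h⟩ := this
  · exact hF' _ _ h
  · rw [← hG] at hb
    obtain ⟨p, rfl⟩ := hb
    rw [h, map_add, hGd, Finsupp.degree_single]
    omega
  · rw [h, map_add, hF' _ _ hb, Finsupp.degree_single]
    omega

end

/-! ### Shifts for complements of chordal graphs. -/

section

variable {𝕜 : Type*} [Field 𝕜] {σ : Type*}

/-- The exponent of the squarefree monomial with support `W`. -/
noncomputable def expo (W : Finset σ) : σ →₀ ℕ := ∑ v ∈ W, Finsupp.single v 1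

theorem expo_apply [DecidableEq σ] (W : Finset σ) (v : σ) :
    expo W v = if v ∈ W then 1 else 0 := by
  simp [expo, Finsupp.finsetSum_apply, Finsupp.single_apply]

theorem expo_insert [DecidableEq σ] {v : σ} {W : Finset σ} (hv : v ∉ W) :
    expo (insert v W) = expo W + Finsupp.single v 1 := by
  rw [expo, Finset.sum_insert hv, add_comm, expo]

theorem expo_injective : Function.Injective (expo : Finset σ → σ →₀ ℕ) := by
  classical
  intro W W' h
  ext v
  have := DFunLike.congr_fun h v
  rw [expo_apply, expo_apply] at this
  by_cases h1 : v ∈ W <;> by_cases h2 : v ∈ W' <;> simp_all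

/-- A monomial free of `v` divides `x_v m` only if it divides `m`. -/
theorem mem_of_X_mul_mem {s : Set (σ →₀ ℕ)} {v : σ} (hs : ∀ a ∈ s, a v = 0)
    {f : MvPolynomial σ 𝕜} (hf : X v * f ∈ Ideal.span ((fun a => monomial a (1 : 𝕜)) '' s)) :
    f ∈ Ideal.span ((fun a => monomial a (1 : 𝕜)) '' s) := by
  classical
  rw [mem_ideal_span_monomial_image] at hf ⊢
  intro t ht
  obtain ⟨a, ha, hle⟩ := hf (Finsupp.single v 1 + t)
    (by rw [support_X_mul]; exact Finset.mem_map_of_mem _ ht)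
  refine ⟨a, ha, fun w => ?_⟩
  have := hle w
  rw [Finsupp.add_apply, Finsupp.single_apply] at this
  split_ifs at this with h
  · rw [← h, hs a ha]
    exact Nat.zero_le _
  · omega

theorem image_X_eq (T : Set σ) : (X : σ → MvPolynomial σ 𝕜) '' T =
    (fun a => monomial a (1 : 𝕜)) '' ((fun v => Finsupp.single v 1) '' T) := by
  rw [Set.image_image]
  rfl

/-- The Koszul resolution of an ideal generated by variables. -/
theorem hasLinearResolution_span_X (T : Finset σ) :
    HasLinearResolution 1 (Ideal.span ((X : σ → MvPolynomial σ 𝕜) '' T)) fun k =>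
      {a | ∃ W ⊆ T, W.card = k + 1 ∧ a = expo W} := by
  classical
  induction T using Finset.induction_on with
  | empty =>
    convert hasLinearResolution_bot (𝕜 := 𝕜) (σ := σ) 1 using 1
    · simp
    · funext k
      ext a
      simp only [Set.mem_ofPred_eq, Set.mem_empty_iff_false, iff_false]
      rintro ⟨W, hW, hc, -⟩
      rw [Finset.subset_empty.1 hW] at hc
      simp at hc
  | insert v T hv ih =>
    -- The cone is applied with `P = S`, since adjoining `x_v` to the generators adds `x_v S`.
    have key := ih.sup_mul hasLinearResolution_top le_top v (fun f hf => by
      rw [image_X_eq] at hf ⊢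
      refine mem_of_X_mul_mem ?_ hf
      rintro _ ⟨u, hu, rfl⟩
      exact Finsupp.single_eq_of_ne (by rintro rfl; exact hv hu))
    convert key using 1
    · rw [Ideal.mul_top, ← Ideal.span_union, Finset.coe_insert, Set.image_insert_eq,
        Set.union_singleton]
    · funext k
      ext a
      simp only [Set.mem_ofPred_eq]
      constructor
      · rintro ⟨W, hW, hc, rfl⟩
        by_cases hvW : v ∈ W
        · obtain ⟨W', hvW', rfl⟩ : ∃ W', v ∉ W' ∧ W = insert v W' :=
            ⟨W.erase v, Finset.notMem_erase v W, (Finset.insert_erase hvW).symm⟩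
          rw [Finset.card_insert_of_notMem hvW'] at hc
          rw [Finset.insert_subset_insert_iff hvW'] at hW
          rw [expo_insert hvW']
          right
          rcases k with _ | k
          · left
            refine ⟨0, ⟨rfl, rfl⟩, ?_⟩
            rw [Finset.card_eq_zero.1 (by omega : W'.card = 0)]
            simp [expo]
          · exact Or.inr ⟨k, rfl, _, ⟨W', hW, by omega, rfl⟩, rfl⟩
        · exact Or.inl ⟨W, (Finset.subset_insert_iff_of_notMem hvW).1 hW, hc, rfl⟩
      · rintro (⟨W, hW, hc, rfl⟩ | ⟨b, ⟨rfl, rfl⟩, rfl⟩ | ⟨k, rfl, b, ⟨W, hW, hc, rfl⟩, rfl⟩)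
        · exact ⟨W, hW.trans (Finset.subset_insert v T), hc, rfl⟩
        · exact ⟨{v}, by simp, by simp, by simp [expo]⟩
        · have hvW : v ∉ W := fun h => hv (hW h)
          refine ⟨insert v W, Finset.insert_subset_insert v hW, ?_, (expo_insert hvW).symm⟩
          rw [Finset.card_insert_of_notMem hvW, hc]

/-- The graph induced on `W` is disconnected. -/
def IsSeparated (G : SimpleGraph σ) (W : Finset σ) : Prop :=
  ∃ A : Set σ, (∃ u ∈ W, u ∈ A) ∧ (∃ w ∈ W, w ∉ A) ∧ ∀ u ∈ W, ∀ w ∈ W, u ∈ A → w ∉ A → ¬ G.Adj u w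

/-- The neighbours of `v` in `W` form a clique, so `v` never joins two components: it attaches to
one of them or is isolated. -/
theorem isSeparated_insert [DecidableEq σ] {G : SimpleGraph σ} {v : σ} {W : Finset σ} (hv : v ∉ W)
    (hs : ∀ u ∈ W, ∀ w ∈ W, G.Adj v u → G.Adj v w → u ≠ w → G.Adj u w) :
    IsSeparated G (insert v W) ↔ IsSeparated G W ∨ (W.Nonempty ∧ ∀ u ∈ W, ¬ G.Adj v u) := by
  constructor
  · rintro ⟨A, ⟨u, hu, huA⟩, ⟨w, hw, hwA⟩, h⟩
    by_cases h1 : ∃ u ∈ W, u ∈ A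
    · by_cases h2 : ∃ w ∈ W, w ∉ A
      · exact Or.inl ⟨A, h1, h2, fun u hu w hw =>
          h u (Finset.mem_insert_of_mem hu) w (Finset.mem_insert_of_mem hw)⟩
      · push Not at h2
        obtain rfl : w = v := by
          by_contra hne
          exact hwA (h2 w (Finset.mem_of_mem_insert_of_ne hw hne))
        obtain ⟨x, hx, -⟩ := h1
        exact Or.inr ⟨⟨x, hx⟩, fun y hy hadj =>
          h y (Finset.mem_insert_of_mem hy) w hw (h2 y hy) hwA hadj.symm⟩
    · push Not at h1
      obtain rfl : u = v := by
        by_contra hne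
        exact h1 u (Finset.mem_of_mem_insert_of_ne hu hne) huA
      obtain hw' : w ∈ W := Finset.mem_of_mem_insert_of_ne hw (by rintro rfl; exact hwA huA)
      exact Or.inr ⟨⟨w, hw'⟩, fun y hy hadj =>
        h u hu y (Finset.mem_insert_of_mem hy) huA (h1 y hy) hadj⟩
  · rintro (⟨A, ⟨u, hu, huA⟩, ⟨w, hw, hwA⟩, h⟩ | ⟨⟨w, hw⟩, h⟩)
    · by_cases hn : ∃ x ∈ W, G.Adj v x ∧ x ∈ A
      · obtain ⟨x, hx, hvx, hxA⟩ := hn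
        have hwv : w ≠ v := by rintro rfl; exact hv hw
        refine ⟨insert v A, ⟨v, by simp, by simp⟩,
          ⟨w, Finset.mem_insert_of_mem hw, by simp [hwA, hwv]⟩,
          fun y hy z hz hyA hzA hadj => ?_⟩
        rw [Set.mem_insert_iff, not_or] at hzA
        have hzW := Finset.mem_of_mem_insert_of_ne hz hzA.1
        rcases eq_or_ne y v with rfl | hyv
        · exact h x hx z hzW hxA hzA.2
            (hs x hx z hzW hvx hadj (by rintro rfl; exact hzA.2 hxA))
        · exact h y (Finset.mem_of_mem_insert_of_ne hy hyv) z hzW (hyA.resolve_left hyv) hzA.2 hadj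
      · push Not at hn
        have huv : u ≠ v := by rintro rfl; exact hv hu
        refine ⟨A \ {v}, ⟨u, Finset.mem_insert_of_mem hu, huA, huv⟩, ⟨v, by simp, by simp⟩,
          fun y hy z hz hyA hzA hadj => ?_⟩
        have hyW := Finset.mem_of_mem_insert_of_ne hy hyA.2
        rcases eq_or_ne z v with rfl | hzv
        · exact hn y hyW hadj.symm hyA.1
        · exact h y hyW z (Finset.mem_of_mem_insert_of_ne hz hzv) hyA.1
            (fun hz => hzA ⟨hz, hzv⟩) hadj
    · refine ⟨{v}, ⟨v, by simp, rfl⟩, ⟨w, Finset.mem_insert_of_mem hw, ?_⟩, ?_⟩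
      · rintro rfl
        exact hv hw
      · rintro y hy z hz rfl hzA
        exact h z (Finset.mem_of_mem_insert_of_ne hz hzA)

/-- The edge ideal of the complement of the graph induced on `U`. -/
noncomputable def coEdgeIdeal (𝕜 : Type*) [Field 𝕜] (G : SimpleGraph σ) (U : Finset σ) :
    Ideal (MvPolynomial σ 𝕜) :=
  Ideal.span {f | ∃ u ∈ U, ∃ w ∈ U, Gᶜ.Adj u w ∧ f = X u * X w}

theorem coEdgeIdeal_eq (G : SimpleGraph σ) (U : Finset σ) :
    coEdgeIdeal 𝕜 G U = Ideal.span ((fun a => monomial a (1 : 𝕜)) ''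
      {a | ∃ u ∈ U, ∃ w ∈ U, Gᶜ.Adj u w ∧ a = Finsupp.single u 1 + Finsupp.single w 1}) := by
  unfold coEdgeIdeal
  congr 1
  ext f
  have (u w : σ) : (X u * X w : MvPolynomial σ 𝕜) =
      monomial (Finsupp.single u 1 + Finsupp.single w 1) 1 := by
    simp [X, monomial_mul]
  constructor
  · rintro ⟨u, hu, w, hw, h, rfl⟩
    exact ⟨_, ⟨u, hu, w, hw, h, rfl⟩, (this u w).symm⟩
  · rintro ⟨_, ⟨u, hu, w, hw, h, rfl⟩, rfl⟩
    exact ⟨u, hu, w, hw, h, (this u w).symm⟩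

open Classical in
theorem coEdgeIdeal_insert (G : SimpleGraph σ) {v : σ} {U : Finset σ} (hv : v ∉ U) :
    coEdgeIdeal 𝕜 G (insert v U) = coEdgeIdeal 𝕜 G U ⊔ Ideal.span {X v} *
      Ideal.span ((X : σ → MvPolynomial σ 𝕜) '' (U.filter fun u => ¬ G.Adj v u : Finset σ)) := by
  rw [Ideal.span_mul_span']
  unfold coEdgeIdeal
  rw [← Ideal.span_union]
  congr 1
  ext f
  simp only [Set.singleton_mul, Set.image_image, Set.mem_union, Set.mem_ofPred_eq, Set.mem_image,
    Finset.coe_filter, Finset.mem_insert, SimpleGraph.compl_adj]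
  constructor
  · rintro ⟨u, hu, w, hw, h, rfl⟩
    rcases hu with rfl | hu
    · rcases hw with rfl | hw
      · exact absurd rfl h.1
      · exact Or.inr ⟨w, ⟨hw, h.2⟩, rfl⟩
    · rcases hw with rfl | hw
      · exact Or.inr ⟨u, ⟨hu, fun h' => h.2 h'.symm⟩, mul_comm _ _⟩
      · exact Or.inl ⟨u, hu, w, hw, h, rfl⟩
  · rintro (⟨u, hu, w, hw, h, rfl⟩ | ⟨w, ⟨hw, h⟩, rfl⟩)
    · exact ⟨u, Or.inr hu, w, Or.inr hw, h, rfl⟩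
    · exact ⟨v, Or.inl rfl, w, Or.inr hw, ⟨by rintro rfl; exact hv hw, h⟩, rfl⟩

/-- The minimal resolution of the edge ideal of the complement of a chordal graph; the ordering
by `e` is a perfect elimination ordering. -/
theorem hasLinearResolution_coEdgeIdeal (G : SimpleGraph σ) (e : σ → ℕ)
    (he : ∀ v u w, e v ≤ e u → e v ≤ e w → G.Adj v u → G.Adj v w → u ≠ w → G.Adj u w)
    (U : Finset σ) :
    HasLinearResolution 2 (coEdgeIdeal 𝕜 G U) fun k =>
      {a | ∃ W ⊆ U, W.card = k + 2 ∧ IsSeparated G W ∧ a = expo W} := by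
  classical
  -- Each inserted vertex has the least `e`-value so far, hence its neighbours among the earlier
  -- ones form a clique.
  induction U using Finset.induction_on_min_value e with
  | empty =>
    convert hasLinearResolution_bot (𝕜 := 𝕜) (σ := σ) 2 using 1
    · simp [coEdgeIdeal]
    · funext k
      ext a
      simp only [Set.mem_ofPred_eq, Set.mem_empty_iff_false, iff_false]
      rintro ⟨W, hW, hc, -⟩
      rw [Finset.subset_empty.1 hW] at hc
      simp at hc
  | insert v U hv hmin ih =>
    set N := U.filter fun u => ¬ G.Adj v u with hN
    -- A non-edge of `G` cannot have both ends in the clique of neighbours of `v`.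
    have hle : coEdgeIdeal 𝕜 G U ≤ Ideal.span ((X : σ → MvPolynomial σ 𝕜) '' N) := by
      refine Ideal.span_le.2 ?_
      rintro _ ⟨u, hu, w, hw, h, rfl⟩
      rw [SimpleGraph.compl_adj] at h
      by_cases hvu : G.Adj v u
      · refine Ideal.mul_mem_left _ _ (Ideal.subset_span ⟨w, ?_, rfl⟩)
        exact Finset.mem_filter.2
          ⟨hw, fun hvw => h.2 (he v u w (hmin u hu) (hmin w hw) hvu hvw h.1)⟩
      · exact Ideal.mul_mem_right _ _ (Ideal.subset_span ⟨u, Finset.mem_filter.2 ⟨hu, hvu⟩, rfl⟩)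
    have key := ih.sup_mul (hasLinearResolution_span_X N) hle v (fun f hf => by
      rw [coEdgeIdeal_eq] at hf ⊢
      refine mem_of_X_mul_mem ?_ hf
      rintro _ ⟨u, hu, w, hw, -, rfl⟩
      rw [Finsupp.add_apply, Finsupp.single_eq_of_ne (by rintro rfl; exact hv hu),
        Finsupp.single_eq_of_ne (by rintro rfl; exact hv hw), add_zero])
    convert key using 1
    · exact coEdgeIdeal_insert G hv
    · funext k
      ext a
      simp only [Set.mem_ofPred_eq]
      have hins : ∀ W ⊆ U, (IsSeparated G (insert v W) ↔
          IsSeparated G W ∨ (W.Nonempty ∧ ∀ u ∈ W, ¬ G.Adj v u)) := fun W hW =>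
        isSeparated_insert (fun h => hv (hW h)) fun u hu w hw =>
          he v u w (hmin u (hW hu)) (hmin w (hW hw))
      -- The three kinds of shift in the cone are the sets without `v`, the sets `v ∪ W'` with `v`
      -- isolated, and the sets `v ∪ W'` with `W'` separated.
      constructor
      · rintro ⟨W, hW, hc, hs, rfl⟩
        by_cases hvW : v ∈ W
        · obtain ⟨W', hvW', rfl⟩ : ∃ W', v ∉ W' ∧ W = insert v W' :=
            ⟨W.erase v, Finset.notMem_erase v W, (Finset.insert_erase hvW).symm⟩
          rw [Finset.card_insert_of_notMem hvW'] at hc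
          rw [Finset.insert_subset_insert_iff hvW'] at hW
          rw [expo_insert hvW']
          right
          rcases (hins W' hW).1 hs with h | ⟨-, h⟩
          · rcases k with _ | k
            · obtain ⟨A, ⟨u, hu, huA⟩, ⟨w, hw, hwA⟩, -⟩ := h
              obtain ⟨x, rfl⟩ := Finset.card_eq_one.1 (by omega : W'.card = 1)
              rw [Finset.mem_singleton] at hu hw
              exact absurd (hw.trans hu.symm ▸ huA) hwA
            · exact Or.inr ⟨k, rfl, _, ⟨W', hW, by omega, h, rfl⟩, rfl⟩
          · exact Or.inl ⟨_, ⟨W', fun u hu => Finset.mem_filter.2 ⟨hW hu, h u hu⟩, by omega, rfl⟩,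
              rfl⟩
        · exact Or.inl ⟨W, (Finset.subset_insert_iff_of_notMem hvW).1 hW, hc, hs, rfl⟩
      · rintro (⟨W, hW, hc, hs, rfl⟩ | ⟨_, ⟨W, hW, hc, rfl⟩, rfl⟩ |
          ⟨k, rfl, b, ⟨W, hW, hc, hs, rfl⟩, rfl⟩)
        · exact ⟨W, hW.trans (Finset.subset_insert v U), hc, hs, rfl⟩
        · have hWU : W ⊆ U := hW.trans (Finset.filter_subset _ _)
          have hvW : v ∉ W := fun h => hv (hWU h)
          refine ⟨insert v W, Finset.insert_subset_insert v hWU, ?_, ?_, (expo_insert hvW).symm⟩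
          · rw [Finset.card_insert_of_notMem hvW, hc]
          · exact (hins W hWU).2 (Or.inr ⟨Finset.card_pos.1 (by omega), fun u hu =>
              (Finset.mem_filter.1 (hW hu)).2⟩)
        · have hvW : v ∉ W := fun h => hv (hW h)
          refine ⟨insert v W, Finset.insert_subset_insert v hW, ?_, (hins W hW).2 (Or.inl hs),
            (expo_insert hvW).symm⟩
          rw [Finset.card_insert_of_notMem hvW, hc]

/-- This is Hochster's formula when the resolution is linear: only the reduced `H_0` of induced
clique complexes contributes. -/
theorem HS_edgeIdeal_compl [Fintype σ] (G : SimpleGraph σ) (e : σ → ℕ)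
    (he : ∀ v u w, e v ≤ e u → e v ≤ e w → G.Adj v u → G.Adj v w → u ≠ w → G.Adj u w) (k : ℕ) :
    HS k (edgeIdeal 𝕜 Gᶜ) = Ideal.span ((fun W => monomial (expo W) (1 : 𝕜)) ''
      {W | W.card = k + 2 ∧ IsSeparated G W}) := by
  have h1 : edgeIdeal 𝕜 Gᶜ = coEdgeIdeal 𝕜 G Finset.univ := by simp [edgeIdeal, coEdgeIdeal]
  obtain ⟨F, hF, -⟩ := hasLinearResolution_coEdgeIdeal (𝕜 := 𝕜) G e he Finset.univ
  rw [h1, F.HS_eq, hF]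
  congr 1
  ext f
  constructor
  · rintro ⟨_, ⟨W, -, hc, hs, rfl⟩, rfl⟩
    exact ⟨W, ⟨hc, hs⟩, rfl⟩
  · rintro ⟨W, ⟨hc, hs⟩, rfl⟩
    exact ⟨_, ⟨W, Finset.subset_univ W, hc, hs, rfl⟩, rfl⟩

end

/-! ### Linear quotients of equigenerated squarefree ideals. -/

section

variable {𝕜 : Type*} [Field 𝕜] {σ : Type*}

theorem expo_le_expo {W W' : Finset σ} : expo W ≤ expo W' ↔ W ⊆ W' := by
  classical
  constructor
  · intro h v hv
    by_contra hv'
    have := h v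
    simp [expo_apply, hv, hv'] at this
  · intro h v
    rw [expo_apply, expo_apply]
    split_ifs with h1 h2
    · exact le_rfl
    · exact absurd (h h1) h2
    · exact Nat.zero_le _
    · exact le_rfl

theorem monomial_mem_span_expo {D : Set (Finset σ)} {a : σ →₀ ℕ} :
    monomial a (1 : 𝕜) ∈ Ideal.span ((fun W => monomial (expo W) (1 : 𝕜)) '' D) ↔
      ∃ W ∈ D, expo W ≤ a := by
  have : (fun W => monomial (expo W) (1 : 𝕜)) '' D =
      (fun a => monomial a (1 : 𝕜)) '' (expo '' D) := by rw [Set.image_image]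
  classical
  rw [this, mem_ideal_span_monomial_image, support_monomial, if_neg one_ne_zero]
  simp

theorem minGens_span_expo {D : Set (Finset σ)} {d : ℕ} (hD : ∀ W ∈ D, W.card = d) :
    minGens (Ideal.span ((fun W => monomial (expo W) (1 : 𝕜)) '' D)) = expo '' D := by
  ext a
  simp only [minGens, Set.mem_ofPred_eq, monomial_mem_span_expo]
  constructor
  · rintro ⟨⟨W, hW, hle⟩, hmin⟩
    exact ⟨W, hW, le_antisymm hle (hmin ⟨W, hW, le_rfl⟩ hle)⟩
  · rintro ⟨W, hW, rfl⟩
    refine ⟨⟨W, hW, le_rfl⟩, ?_⟩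
    rintro b ⟨W', hW', hle⟩ hb
    have : W' = W := Finset.eq_of_subset_of_card_le (expo_le_expo.1 (hle.trans hb))
      (by rw [hD W hW, hD W' hW'])
    rwa [← this]

theorem mem_colon_monomial {s : Set (σ →₀ ℕ)} {a : σ →₀ ℕ} {f : MvPolynomial σ 𝕜} :
    f ∈ (Ideal.span ((fun b => monomial b (1 : 𝕜)) '' s)).colon {monomial a (1 : 𝕜)} ↔
      ∀ t ∈ f.support, ∃ b ∈ s, b ≤ t + a := by
  rw [Submodule.mem_colon_singleton, smul_eq_mul, mem_ideal_span_monomial_image]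
  constructor
  · intro h t ht
    apply h
    rw [mem_support_iff, coeff_mul_monomial, mul_one]
    exact mem_support_iff.1 ht
  · intro h t ht
    rw [mem_support_iff, coeff_mul_monomial', mul_one] at ht
    split_ifs at ht with hle
    · obtain ⟨b, hb, hb'⟩ := h (t - a) (mem_support_iff.2 ht)
      exact ⟨b, hb, by rwa [tsub_add_cancel_of_le hle] at hb'⟩
    · exact absurd rfl ht

/-- A criterion for linear quotients of an ideal generated by squarefree monomials of the same
degree, which are ordered by decreasing keys. -/
theorem hasLinearQuotients_span_expo [DecidableEq σ] {L : Type*} [LinearOrder L]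
    {D : Finset (Finset σ)} {d : ℕ} (hD : ∀ W ∈ D, W.card = d) (key : Finset σ → L)
    (hkey : Function.Injective key)
    (h : ∀ W ∈ D, ∀ W' ∈ D, key W < key W' →
      ∃ W'' ∈ D, key W < key W'' ∧ ∃ t ∈ W', t ∉ W ∧ W'' ⊆ insert t W) :
    HasLinearQuotients
      (Ideal.span ((fun W => monomial (expo W) (1 : 𝕜)) '' (D : Set (Finset σ)))) := by
  -- The dual order makes the increasing enumeration list larger keys first.
  let K : Finset Lᵒᵈ := D.image fun W => OrderDual.toDual (key W)
  let f : Fin K.card ↪o Lᵒᵈ := K.orderEmbOfFin rfl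
  have hf : ∀ i, ∃ W ∈ D, OrderDual.toDual (key W) = f i := fun i =>
    Finset.mem_image.1 (K.orderEmbOfFin_mem rfl i)
  choose W hW hWf using hf
  have hlt : ∀ i j, i < j ↔ key (W j) < key (W i) := fun i j => by
    rw [← f.lt_iff_lt, ← hWf, ← hWf]
    rfl
  have hsurj : ∀ U ∈ D, ∃ i, W i = U := by
    intro U hU
    have : OrderDual.toDual (key U) ∈ Set.range f := by
      rw [Finset.range_orderEmbOfFin]
      exact Finset.mem_coe.2 (Finset.mem_image_of_mem _ hU)
    obtain ⟨i, hi⟩ := this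
    exact ⟨i, hkey (OrderDual.toDual.injective ((hWf i).trans hi))⟩
  refine ⟨K.card, fun i => expo (W i), ?_, ?_, ?_⟩
  · intro i j hij
    apply f.injective
    rw [← hWf, ← hWf, expo_injective hij]
  · rw [minGens_span_expo hD]
    ext a
    constructor
    · rintro ⟨i, rfl⟩
      exact ⟨_, hW i, rfl⟩
    · rintro ⟨U, hU, rfl⟩
      obtain ⟨i, rfl⟩ := hsurj U hU
      exact ⟨i, rfl⟩
  · intro i _
    have hs : {f | ∃ j, j < i ∧ f = monomial (expo (W j)) (1 : 𝕜)} =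
        (fun b => monomial b (1 : 𝕜)) '' {b | ∃ j < i, b = expo (W j)} := by
      ext f
      constructor
      · rintro ⟨j, hj, rfl⟩
        exact ⟨_, ⟨j, hj, rfl⟩, rfl⟩
      · rintro ⟨_, ⟨j, hj, rfl⟩, rfl⟩
        exact ⟨j, hj, rfl⟩
    refine ⟨{t | ∃ l < i, W l ⊆ insert t (W i)}, ?_⟩
    ext g
    rw [hs, mem_colon_monomial, mem_ideal_span_X_image]
    refine forall₂_congr fun s _ => ?_
    constructor
    · rintro ⟨_, ⟨j, hj, rfl⟩, hle⟩
      obtain ⟨W'', hW'', hk, t, ht, ht', hsub⟩ :=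
        h (W i) (hW i) (W j) (hW j) ((hlt j i).1 hj)
      obtain ⟨l, rfl⟩ := hsurj W'' hW''
      -- Since `t` lies in `W j` but not in `W i`, divisibility of `x^s x^(W i)` by `x^(W j)` forces
      -- `x_t` to divide `x^s`.
      refine ⟨t, ⟨l, (hlt l i).2 hk, hsub⟩, fun h0 => ?_⟩
      have := hle t
      simp [expo_apply, ht, ht', h0] at this
    · rintro ⟨t, ⟨l, hl, hsub⟩, ht⟩
      refine ⟨_, ⟨l, hl, rfl⟩, fun v => ?_⟩
      rw [Finsupp.add_apply, expo_apply, expo_apply]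
      split_ifs with h1 h2
      · omega
      · rcases Finset.mem_insert.1 (hsub h1) with rfl | h3
        · omega
        · exact absurd h3 h2
      · omega
      · omega

/-- The only colon ideal is generated by a monomial `x^(U \ W)` or `x^(W \ U)`, which here is not a
variable. -/
theorem not_hasLinearQuotients_pair [DecidableEq σ] {U W : Finset σ} (hUW : U ≠ W)
    (hcard : U.card = W.card) (h₁ : ∀ t, ¬ U ⊆ insert t W) (h₂ : ∀ t, ¬ W ⊆ insert t U) :
    ¬ HasLinearQuotients
      (Ideal.span ((fun W => monomial (expo W) (1 : 𝕜)) '' ({U, W} : Set (Finset σ)))) := by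
  rintro ⟨q, m, hinj, hrange, hm⟩
  rw [minGens_span_expo (d := W.card) (by simp [hcard]), Set.image_pair] at hrange
  wlog hlt : ∃ i j, i < j ∧ m i = expo U ∧ m j = expo W generalizing U W
  · obtain ⟨i, hi⟩ : expo U ∈ Set.range m := by rw [hrange]; simp
    obtain ⟨j, hj⟩ : expo W ∈ Set.range m := by rw [hrange]; simp
    have hij : i ≠ j := by
      rintro rfl
      exact hUW (expo_injective (hi.symm.trans hj))
    refine this hUW.symm hcard.symm h₂ h₁ (by rw [hrange, Set.pair_comm]) ⟨j, i, ?_, hj, hi⟩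
    exact lt_of_le_of_ne (not_lt.1 fun h => hlt ⟨i, j, h, hi, hj⟩) hij.symm
  obtain ⟨i, j, hij, hi, hj⟩ := hlt
  obtain ⟨T, hT⟩ := hm j (by omega)
  have hs : {f | ∃ l, l < j ∧ f = monomial (m l) (1 : 𝕜)} =
      (fun b => monomial b (1 : 𝕜)) '' {expo U} := by
    ext f
    simp only [Set.mem_ofPred_eq, Set.image_singleton, Set.mem_singleton_iff]
    constructor
    · rintro ⟨l, hl, rfl⟩
      have : m l ∈ ({expo U, expo W} : Set _) := by rw [← hrange]; exact ⟨l, rfl⟩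
      rcases this with h | h
      · rw [h]
      · exact absurd (hinj (h.trans hj.symm)) hl.ne
    · rintro rfl
      exact ⟨i, hij, by rw [hi]⟩
  rw [hs, hj] at hT
  classical
  -- The colon contains `x^U`, so `T` is nonempty; any `t ∈ T` then gives `U ⊆ insert t W`.
  have h1 : monomial (expo U) (1 : 𝕜) ∈ Ideal.span ((X : σ → MvPolynomial σ 𝕜) '' T) := by
    rw [← hT, mem_colon_monomial]
    intro t ht
    rw [support_monomial, if_neg one_ne_zero, Finset.mem_singleton] at ht
    exact ⟨_, rfl, by rw [ht]; exact le_self_add⟩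
  have h2 : ∀ t ∈ T, ¬ expo U ≤ Finsupp.single t 1 + expo W → False := by
    intro t ht hle
    have : (X t : MvPolynomial σ 𝕜) ∈ Ideal.span ((X : σ → MvPolynomial σ 𝕜) '' T) :=
      Ideal.subset_span ⟨t, ht, rfl⟩
    rw [← hT, mem_colon_monomial] at this
    obtain ⟨b, rfl, hb⟩ := this (Finsupp.single t 1) (by simp)
    exact hle hb
  rw [mem_ideal_span_X_image] at h1
  obtain ⟨t, ht, -⟩ := h1 (expo U) (by simp)
  refine h₁ t fun v hv => ?_
  have := not_not.1 (h2 t ht) v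
  rw [Finsupp.add_apply, expo_apply, if_pos hv, expo_apply, Finsupp.single_apply] at this
  rw [Finset.mem_insert]
  by_contra! hne
  rw [if_neg hne.1.symm, if_neg hne.2] at this
  omega

end

/-! ### Relabelling the graph as a path with two apexes. -/

theorem isSeparated_comap {V V' : Type*} (G : SimpleGraph V') (p : V ↪ V') (W : Finset V) :
    IsSeparated (G.comap p) W ↔ IsSeparated G (W.map p) := by
  constructor
  · rintro ⟨A, ⟨u, hu, huA⟩, ⟨w, hw, hwA⟩, h⟩
    refine ⟨p '' A, ⟨p u, Finset.mem_map_of_mem p hu, u, huA, rfl⟩,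
      ⟨p w, Finset.mem_map_of_mem p hw, ?_⟩, ?_⟩
    · rwa [p.injective.mem_set_image]
    · intro x hx y hy hxA hyA
      obtain ⟨x, hxW, rfl⟩ := Finset.mem_map.1 hx
      obtain ⟨y, hyW, rfl⟩ := Finset.mem_map.1 hy
      rw [p.injective.mem_set_image] at hxA hyA
      exact h x hxW y hyW hxA hyA
  · rintro ⟨A, ⟨u, hu, huA⟩, ⟨w, hw, hwA⟩, h⟩
    obtain ⟨u, huW, rfl⟩ := Finset.mem_map.1 hu
    obtain ⟨w, hwW, rfl⟩ := Finset.mem_map.1 hw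
    exact ⟨p ⁻¹' A, ⟨u, huW, huA⟩, ⟨w, hwW, hwA⟩, fun x hx y hy =>
      h _ (Finset.mem_map_of_mem p hx) _ (Finset.mem_map_of_mem p hy)⟩

/-- The graph `H_n` up to relabelling: `2, …, n - 1` is a path, `0` is joined to all vertices but
`2`, and `1` is joined to all vertices but `n - 1`. -/
def apexGraph (n : ℕ) : SimpleGraph ℕ where
  Adj i j := i ≠ j ∧ ((i = 0 ∧ j ≠ 2) ∨ (j = 0 ∧ i ≠ 2) ∨ (i = 1 ∧ j ≠ n - 1) ∨
    (j = 1 ∧ i ≠ n - 1) ∨ (2 ≤ i ∧ j = i + 1) ∨ (2 ≤ j ∧ i = j + 1))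
  symm := ⟨fun i j h => by omega⟩
  loopless := ⟨fun i h => h.1 rfl⟩

theorem apexGraph_adj {n i j : ℕ} : (apexGraph n).Adj i j ↔ i ≠ j ∧ ((i = 0 ∧ j ≠ 2) ∨
    (j = 0 ∧ i ≠ 2) ∨ (i = 1 ∧ j ≠ n - 1) ∨ (j = 1 ∧ i ≠ n - 1) ∨ (2 ≤ i ∧ j = i + 1) ∨
    (2 ≤ j ∧ i = j + 1)) := Iff.rfl

/-- The isomorphism from `H_n` to `apexGraph n`. -/
def position (n : ℕ) (hn : 6 ≤ n) : Fin n ↪ ℕ where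
  -- The path in `H_n` runs `x_1, …, x_{n-4}, x_{n-2}, x_{n-3}`, with its last two indices out of
  -- order; the apexes are `x_{n-1}` and `x_n`.
  toFun v := if (v : ℕ) = n - 2 then 0 else if (v : ℕ) = n - 1 then 1 else
    if (v : ℕ) = n - 4 then n - 1 else if (v : ℕ) = n - 3 then n - 2 else v + 2
  inj' u v h := by
    ext
    have := u.2
    have := v.2
    dsimp only at h
    split_ifs at h <;> omega

theorem position_apply (n : ℕ) (hn : 6 ≤ n) (v : Fin n) : position n hn v =
    if (v : ℕ) = n - 2 then 0 else if (v : ℕ) = n - 1 then 1 else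
    if (v : ℕ) = n - 4 then n - 1 else if (v : ℕ) = n - 3 then n - 2 else v + 2 := rfl

theorem position_lt (n : ℕ) (hn : 6 ≤ n) (v : Fin n) : position n hn v < n := by
  have := v.2
  rw [position_apply]
  split_ifs <;> omega

theorem exists_position_eq (n : ℕ) (hn : 6 ≤ n) {i : ℕ} (hi : i < n) :
    ∃ v, position n hn v = i := by
  have h : (Finset.univ.map (position n hn)) = Finset.range n := by
    apply Finset.eq_of_subset_of_card_le
    · intro x hx
      obtain ⟨v, -, rfl⟩ := Finset.mem_map.1 hx
      exact Finset.mem_range.2 (position_lt n hn v)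
    · simp
  obtain ⟨v, -, hv⟩ := Finset.mem_map.1 (h.ge (Finset.mem_range.2 hi))
  exact ⟨v, hv⟩

theorem graphH_eq_comap (n : ℕ) (hn : 6 ≤ n) :
    graphH n = (apexGraph n).comap (position n hn) := by
  ext ⟨i, hi⟩ ⟨j, hj⟩
  rw [graphH, SimpleGraph.fromRel_adj, SimpleGraph.comap_adj, apexGraph_adj, Ne, Fin.ext_iff,
    position_apply, position_apply]
  obtain ⟨m, rfl⟩ := Nat.exists_eq_add_of_le hn
  obtain ⟨e1, e2, e3, e4, e5⟩ : 6 + m - 1 = m + 5 ∧ 6 + m - 2 = m + 4 ∧ 6 + m - 3 = m + 3 ∧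
    6 + m - 4 = m + 2 ∧ 6 + m - 5 = m + 1 := by omega
  simp only [e1, e2, e3, e4, e5]
  have h : ∀ k < 6 + m, k = m + 4 ∨ k = m + 5 ∨ k = m + 2 ∨ k = m + 3 ∨ (k ≠ m + 4 ∧ k ≠ m + 5 ∧
    k ≠ m + 2 ∧ k ≠ m + 3 ∧ k ≤ m + 1) := by omega
  rcases h i hi with rfl | rfl | rfl | rfl | ⟨i1, i2, i3, i4, i5⟩ <;>
  rcases h j hj with rfl | rfl | rfl | rfl | ⟨j1, j2, j3, j4, j5⟩ <;>
  simp [*] <;> omega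

/-- The elimination order of `apexGraph n`. -/
def eliminationRank (n i : ℕ) : ℕ :=
  if i = n - 1 then 0 else if i = 0 then n else if i = 1 then n + 1 else i

/-- The vertex `n - 1` goes first because `n - 2` is adjacent to both `n - 1` and `1`, which are not
adjacent. The path is then peeled from `2` upwards, and the apexes come last. -/
theorem apexGraph_elimination {n i j k : ℕ} (hn : 6 ≤ n) (hi : i < n) (hj : j < n) (hk : k < n)
    (h₁ : eliminationRank n i ≤ eliminationRank n j)
    (h₂ : eliminationRank n i ≤ eliminationRank n k) (hij : (apexGraph n).Adj i j)
    (hik : (apexGraph n).Adj i k) (hjk : j ≠ k) : (apexGraph n).Adj j k := by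
  obtain ⟨m, rfl⟩ := Nat.exists_eq_add_of_le hn
  have e1 : 6 + m - 1 = m + 5 := by omega
  rw [apexGraph_adj] at *
  unfold eliminationRank at h₁ h₂
  simp only [e1] at h₁ h₂ hij hik ⊢
  split_ifs at h₁ h₂ <;> omega

/-! ### Disconnected vertex sets and the exchange property. -/

/-- The sets of vertices that induce a disconnected subgraph of `apexGraph n`. -/
def IsCut (n : ℕ) (S : Finset ℕ) : Prop :=
  (0 ∉ S ∧ 1 ∉ S ∧ ∃ i ∈ S, ∃ k ∈ S, ∃ j ∉ S, i < j ∧ j < k) ∨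
    (0 ∈ S ∧ 1 ∉ S ∧ 2 ∈ S ∧ 3 ∉ S) ∨ (1 ∈ S ∧ 0 ∉ S ∧ n - 1 ∈ S ∧ n - 2 ∉ S)

/-- Two apexes connect everything. One apex reaches all but its missed path end, which is cut off
exactly when its path neighbour is absent. Without apexes, connected means having no gap. -/
theorem isSeparated_apexGraph {n : ℕ} (hn : 6 ≤ n) {S : Finset ℕ}
    (hS : ∀ i ∈ S, i < n) :
    IsSeparated (apexGraph n) S ↔ IsCut n S := by
  constructor
  · rintro ⟨A, ⟨u, hu, huA⟩, ⟨w, hw, hwA⟩, h⟩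
    have hiff : ∀ i ∈ S, ∀ j ∈ S, (apexGraph n).Adj i j → (i ∈ A ↔ j ∈ A) := by
      intro i hi j hj hij
      by_cases h1 : i ∈ A <;> by_cases h2 : j ∈ A
      · simp [h1, h2]
      · exact absurd hij (h i hi j hj h1 h2)
      · exact absurd hij.symm (h j hj i hi h2 h1)
      · simp [h1, h2]
    have hne : ∀ x, ¬ ∀ y ∈ S, (y ∈ A ↔ x ∈ A) := fun x hx => hwA ((hx w hw).2 ((hx u hu).1 huA))
    simp only [apexGraph_adj] at hiff
    by_cases h0 : 0 ∈ S <;> by_cases h1 : 1 ∈ S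
    · refine absurd (fun y hy => ?_) (hne 0)
      by_cases hy2 : y = 2
      · subst hy2
        exact (hiff 2 hy 1 h1 (by omega)).trans (hiff 1 h1 0 h0 (by omega))
      · by_cases hy0 : y = 0
        · rw [hy0]
        · exact hiff y hy 0 h0 (by omega)
    · refine Or.inr (Or.inl ⟨h0, h1, ?_⟩)
      by_contra hc
      refine absurd (fun y hy => ?_) (hne 0)
      by_cases hy2 : y = 2
      · subst hy2
        have h3 : 3 ∈ S := by_contra fun h3 => hc ⟨hy, h3⟩
        exact (hiff 2 hy 3 h3 (by omega)).trans (hiff 3 h3 0 h0 (by omega))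
      · by_cases hy0 : y = 0
        · rw [hy0]
        · exact hiff y hy 0 h0 (by omega)
    · refine Or.inr (Or.inr ⟨h1, h0, ?_⟩)
      by_contra hc
      refine absurd (fun y hy => ?_) (hne 1)
      by_cases hy2 : y = n - 1
      · subst hy2
        have h3 : n - 2 ∈ S := by_contra fun h3 => hc ⟨hy, h3⟩
        exact (hiff _ hy _ h3 (by omega)).trans (hiff _ h3 1 h1 (by omega))
      · by_cases hy0 : y = 1
        · rw [hy0]
        · exact hiff y hy 1 h1 (by omega)
    · refine Or.inl ⟨h0, h1, ?_⟩
      by_contra! hc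
      have key : ∀ i ∈ S, ∀ d, i + d ∈ S → (i ∈ A ↔ i + d ∈ A) := by
        intro i hi d
        have hi0 : i ≠ 0 := by rintro rfl; exact h0 hi
        have hi1 : i ≠ 1 := by rintro rfl; exact h1 hi
        induction d with
        | zero => simp
        | succ d ih =>
          intro hd
          have hd' : i + d ∈ S := by
            rcases Nat.eq_zero_or_pos d with rfl | hpos
            · exact hi
            · by_contra hd'
              have := hc i hi _ hd _ hd' (by omega)
              omega
          exact (ih hd').trans (hiff _ hd' _ hd (by omega))
      refine absurd (fun y hy => ?_) (hne u)
      rcases le_total u y with hle | hle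
      · obtain ⟨d, rfl⟩ := Nat.exists_eq_add_of_le hle
        exact (key u hu d hy).symm
      · obtain ⟨d, rfl⟩ := Nat.exists_eq_add_of_le hle
        exact key y hy d hu
  · have hmem : ∀ {i j}, i ∈ S → j ∉ S → i ≠ j := by rintro i j hi hj rfl; exact hj hi
    rintro (⟨h0, h1, i, hi, k, hk, j, hj, hij, hjk⟩ | ⟨h0, h1, h2, h3⟩ | ⟨h1, h0, h2, h3⟩)
    · refine ⟨{x | x < j}, ⟨i, hi, hij⟩, ⟨k, hk, not_lt.2 hjk.le⟩, ?_⟩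
      intro x hx y hy hxj hyj
      have := hmem hx h0
      have := hmem hx h1
      have := hmem hy h0
      have := hmem hy h1
      have := hmem hy hj
      rw [Set.mem_ofPred_eq] at hxj hyj
      rw [apexGraph_adj]
      omega
    · refine ⟨{2}, ⟨2, h2, rfl⟩, ⟨0, h0, by simp⟩, ?_⟩
      rintro x hx y hy rfl hyj
      have := hmem hy h1
      have := hmem hy h3
      rw [apexGraph_adj]
      omega
    · refine ⟨{n - 1}, ⟨n - 1, h2, rfl⟩, ⟨1, h1, by simp; omega⟩, ?_⟩
      rintro x hx y hy rfl hyj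
      have := hmem hy h0
      have := hmem hy h3
      have : y ≠ n - 1 := hyj
      have := hS y hy
      rw [apexGraph_adj]
      omega

/-- The new set is `S'` itself or arises from `S` by trading some `u` for a larger `t ∈ S'`, which
raises the colexicographic order; `u` is chosen so that a gap is left. -/
theorem IsCut.exists_exchange {n : ℕ} (hn : 6 ≤ n) {S S' : Finset ℕ} (hS : IsCut n S)
    (hS' : IsCut n S') (hn' : ∀ i ∈ S', i < n) (hcard : S.card = S'.card) (hs : S.card < n - 2)
    (hlt : toColex S < toColex S') : ∃ S'', IsCut n S'' ∧ S''.card = S.card ∧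
      toColex S < toColex S'' ∧ ∃ t ∈ S', t ∉ S ∧ S'' ⊆ insert t S := by
  have hmem : ∀ {T : Finset ℕ} {i j : ℕ}, i ∈ T → j ∉ T → i ≠ j := by
    rintro T i j hi hj rfl
    exact hj hi
  rw [Finset.Colex.toColex_lt_toColex_iff_exists_forall_lt] at hlt
  have hexch : ∀ {t u}, t ∉ S → u ∈ S → u < t → (insert t (S.erase u)).card = S.card ∧
      toColex S < toColex (insert t (S.erase u)) ∧ insert t (S.erase u) ⊆ insert t S := by
    intro t u ht hu hut
    refine ⟨?_, ?_, Finset.insert_subset_insert t (S.erase_subset u)⟩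
    · rw [Finset.card_insert_of_notMem (fun h => ht (Finset.mem_of_mem_erase h)),
        Finset.card_erase_add_one hu]
    · rw [Finset.Colex.toColex_lt_toColex_iff_exists_forall_lt]
      refine ⟨t, Finset.mem_insert_self _ _, ht, fun x hx hx' => ?_⟩
      by_cases hxu : x = u
      · rwa [hxu]
      · exact absurd (Finset.mem_insert_of_mem (Finset.mem_erase.2 ⟨hxu, hx⟩)) hx'
  by_cases hself : ∃ t ∈ S', t ∉ S ∧ S' ⊆ insert t S
  · exact ⟨S', hS', hcard.symm,
      Finset.Colex.toColex_lt_toColex_iff_exists_forall_lt.2 hlt, hself⟩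
  -- By now `S' \ S` has at least two elements.
  have hpair : ∀ a b, (∀ t ∈ S', t ∉ S → t = a ∨ t = b) → a ∈ S' ∧ a ∉ S ∧ b ∈ S' ∧ b ∉ S := by
    intro a b hab
    push Not at hself
    obtain ⟨w, hw, hwS, -⟩ := hlt
    obtain ⟨x, hx, hx'⟩ := Finset.not_subset.1 (hself w hw hwS)
    rw [Finset.mem_insert, not_or] at hx'
    rcases hab w hw hwS with rfl | rfl <;> rcases hab x hx hx'.2 with rfl | rfl <;> grind
  -- The whole path has `n - 2` vertices; this is where the strict bound on the size enters.
  have hgap : ∀ {T : Finset ℕ}, T.card < n - 2 → 2 ∈ T → n - 1 ∈ T → 0 ∉ T → 1 ∉ T →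
      IsCut n T := by
    intro T hT h2 hn1 h0 h1
    refine Or.inl ⟨h0, h1, 2, h2, n - 1, hn1, ?_⟩
    by_contra! hc
    have : Finset.Icc 2 (n - 1) ⊆ T := by
      intro x hx
      rw [Finset.mem_Icc] at hx
      by_contra hxT
      have := hc x hxT (by have := hmem h2 hxT; omega)
      have := hmem hn1 hxT
      omega
    have := Finset.card_le_card this
    rw [Nat.card_Icc] at this
    omega
  rcases hS with ⟨h0, h1, -⟩ | ⟨h0, h1, h2, h3⟩ | ⟨h1, h0, h2, h3⟩
  -- No apex in `S`: take `t` largest in `S' \ S` and `u` largest in `S` below `t`. Removing `u`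
  -- leaves a gap if `S` has an element below `u`.
  · obtain ⟨w, hw, hwS, hlt⟩ := hlt
    have hne : (S' \ S).Nonempty := ⟨w, Finset.mem_sdiff.2 ⟨hw, hwS⟩⟩
    obtain ⟨t, ht, htmax⟩ := Finset.exists_max_image (S' \ S) id hne
    rw [Finset.mem_sdiff] at ht
    have hne' : (S.filter (· < t)).Nonempty := by
      obtain ⟨x, hx, hx'⟩ : ∃ x ∈ S, x ∉ S' := by
        by_contra! hsub
        exact hwS (Finset.eq_of_subset_of_card_le hsub hcard.ge ▸ hw)
      exact ⟨x, Finset.mem_filter.2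
        ⟨hx, (hlt x hx hx').trans_le (htmax w (Finset.mem_sdiff.2 ⟨hw, hwS⟩))⟩⟩
    obtain ⟨u, hu, humax⟩ := Finset.exists_max_image (S.filter (· < t)) id hne'
    rw [Finset.mem_filter] at hu
    obtain ⟨e1, e2, e3⟩ := hexch ht.2 hu.1 hu.2
    refine ⟨insert t (S.erase u), ?_, e1, e2, t, ht.1, ht.2, e3⟩
    have hu0 := hmem hu.1 h0
    by_cases hx : ∃ x ∈ S, x < u
    · obtain ⟨x, hx, hxu⟩ := hx
      refine Or.inl ⟨?_, ?_, x, ?_, t, Finset.mem_insert_self _ _, u, ?_, hxu, hu.2⟩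
      · simp only [Finset.mem_insert, Finset.mem_erase]; grind
      · simp only [Finset.mem_insert, Finset.mem_erase]; have := hmem hu.1 h1; grind
      · simp only [Finset.mem_insert, Finset.mem_erase]; exact Or.inr ⟨hxu.ne, hx⟩
      · simp only [Finset.mem_insert, Finset.mem_erase]; grind
    -- Here `u` is the only element of `S` below `t`, and every element of `S` above `t` lies in
    -- `S'`, so the exchange produces `S'`.
    · push Not at hx
      have : insert t (S.erase u) = S' := by
        apply Finset.eq_of_subset_of_card_le
        · intro y hy
          rcases Finset.mem_insert.1 hy with rfl | hy
          · exact ht.1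
          · rw [Finset.mem_erase] at hy
            by_contra hyS
            have h1 := (hlt y hy.2 hyS).trans_le (htmax w (Finset.mem_sdiff.2 ⟨hw, hwS⟩))
            have h2 := humax y (Finset.mem_filter.2 ⟨hy.2, h1⟩)
            have h3 := hx y hy.2
            exact hy.1 (le_antisymm h2 h3)
        · rw [e1, hcard]
      rwa [this]
  -- Apex `0` in `S`: trading it for some `t ≥ 4` keeps the gap at `3`.
  · by_cases ht : ∃ t ∈ S', t ∉ S ∧ 4 ≤ t
    · obtain ⟨t, ht, htS, h4⟩ := ht
      obtain ⟨e1, e2, e3⟩ := hexch htS h0 (by omega)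
      refine ⟨insert t (S.erase 0), Or.inl ⟨?_, ?_, 2, ?_, t, Finset.mem_insert_self _ _, 3, ?_,
        by omega, by omega⟩, e1, e2, t, ht, htS, e3⟩ <;>
      simp only [Finset.mem_insert, Finset.mem_erase] <;> grind
    -- Otherwise `S' \ S = {1, 3}`; apex `1` forces `n - 1` into `S'`, hence into `S`, and trading
    -- `0` for `3` leaves a gap by size.
    · push Not at ht
      obtain ⟨h1', -, h3', -⟩ := hpair 1 3 (by
        intro t htS' htS
        have := ht t htS' htS
        have := hmem h0 htS
        have := hmem h2 htS
        omega)
      have hn1 : n - 1 ∈ S' := by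
        rcases hS' with h | h | h
        · exact absurd h1' h.2.1
        · exact absurd h1' h.2.1
        · exact h.2.2.1
      have hn1S : n - 1 ∈ S := by
        by_contra hc
        have := ht _ hn1 hc
        omega
      obtain ⟨e1, e2, e3⟩ := hexch h3 h0 (by omega)
      refine ⟨insert 3 (S.erase 0), hgap (e1 ▸ hs) ?_ ?_ ?_ ?_, e1, e2, 3, h3', h3, e3⟩ <;>
      simp only [Finset.mem_insert, Finset.mem_erase] <;> grind
  -- Apex `1` in `S`: the mirror argument, with the gap at `n - 2` and the exceptional pair `{0, n -
  -- 2}`.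
  · by_cases ht : ∃ t ∈ S', t ∉ S ∧ 2 ≤ t ∧ t < n - 2
    · obtain ⟨t, ht, htS, h4, h5⟩ := ht
      obtain ⟨e1, e2, e3⟩ := hexch htS h1 (by omega)
      refine ⟨insert t (S.erase 1), Or.inl ⟨?_, ?_, t, Finset.mem_insert_self _ _, n - 1, ?_,
        n - 2, ?_, by omega, by omega⟩, e1, e2, t, ht, htS, e3⟩ <;>
      simp only [Finset.mem_insert, Finset.mem_erase] <;> grind
    · push Not at ht
      obtain ⟨h0', -, h3', -⟩ := hpair 0 (n - 2) (by
        intro t htS' htS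
        have := ht t htS' htS
        have := hmem h1 htS
        have := hmem h2 htS
        have := hn' t htS'
        omega)
      have h2' : 2 ∈ S' := by
        rcases hS' with h | h | h
        · exact absurd h0' h.1
        · exact h.2.2.1
        · exact absurd h0' h.2.1
      have h2S : 2 ∈ S := by
        by_contra hc
        have := ht _ h2' hc
        omega
      obtain ⟨e1, e2, e3⟩ := hexch h3 h1 (by omega)
      refine ⟨insert (n - 2) (S.erase 1), hgap (e1 ▸ hs) ?_ ?_ ?_ ?_, e1, e2, n - 2,
        h3', h3, e3⟩ <;>
      simp only [Finset.mem_insert, Finset.mem_erase] <;> grind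

/-- A set without apexes misses `0`, `1` and a gap, three vertices in all; the other two kinds miss
a specific pair. -/
theorem IsCut.card_lt_or {n : ℕ} {S : Finset ℕ} (hS : IsCut n S) (hn : 6 ≤ n)
    (hlt : ∀ i ∈ S, i < n) :
    S.card < n - 2 ∨ S ⊆ Finset.range n \ {1, 3} ∨ S ⊆ Finset.range n \ {0, n - 2} := by
  have hsub : ∀ T : Finset ℕ, (∀ i ∈ T, i ∉ S) → S ⊆ Finset.range n \ T := fun T hT i hi =>
    Finset.mem_sdiff.2 ⟨Finset.mem_range.2 (hlt i hi), fun h => hT i h hi⟩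
  rcases hS with ⟨h0, h1, i, hi, k, hk, j, hj, hij, hjk⟩ | ⟨h0, h1, h2, h3⟩ | ⟨h1, h0, h2, h3⟩
  · left
    have hk' := hlt k hk
    have hi0 : i ≠ 0 := by rintro rfl; exact h0 hi
    have hi1 : i ≠ 1 := by rintro rfl; exact h1 hi
    have h := Finset.card_le_card (hsub {0, 1, j} (by simp [h0, h1, hj]))
    have hT : ({0, 1, j} : Finset ℕ) ⊆ Finset.range n := by
      intro x hx
      simp only [Finset.mem_insert, Finset.mem_singleton] at hx
      rw [Finset.mem_range]
      omega
    have hc : ({0, 1, j} : Finset ℕ).card = 3 :=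
      Finset.card_eq_three.2 ⟨0, 1, j, by omega, by omega, by omega, rfl⟩
    rw [Finset.card_sdiff_of_subset hT, hc, Finset.card_range] at h
    omega
  · exact Or.inr (Or.inl (hsub _ (by simp [h1, h3])))
  · exact Or.inr (Or.inr (hsub _ (by simp [h0, h3])))

theorem card_range_sdiff_pair {n a b : ℕ} (ha : a < n) (hb : b < n) (hab : a ≠ b) :
    (Finset.range n \ {a, b}).card = n - 2 := by
  rw [Finset.card_sdiff_of_subset, Finset.card_pair hab, Finset.card_range]
  intro x hx
  simp only [Finset.mem_insert, Finset.mem_singleton] at hx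
  rw [Finset.mem_range]
  omega

theorem IsCut.card_le {n : ℕ} {S : Finset ℕ} (hS : IsCut n S) (hn : 6 ≤ n)
    (hlt : ∀ i ∈ S, i < n) : S.card ≤ n - 2 := by
  rcases hS.card_lt_or hn hlt with h | h | h
  · exact h.le
  · exact (Finset.card_le_card h).trans
      (card_range_sdiff_pair (by omega) (by omega) (by omega)).le
  · exact (Finset.card_le_card h).trans
      (card_range_sdiff_pair (by omega) (by omega) (by omega)).le

theorem isCut_card_eq_iff {n : ℕ} (hn : 6 ≤ n) {S : Finset ℕ} (hlt : ∀ i ∈ S, i < n) :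
    S.card = n - 2 ∧ IsCut n S ↔
      S = Finset.range n \ {1, 3} ∨ S = Finset.range n \ {0, n - 2} := by
  constructor
  · rintro ⟨hc, hS⟩
    rcases hS.card_lt_or hn hlt with h | h | h
    · omega
    · exact Or.inl (Finset.eq_of_subset_of_card_le h
        (by rw [hc, card_range_sdiff_pair (by omega) (by omega) (by omega)]))
    · exact Or.inr (Finset.eq_of_subset_of_card_le h
        (by rw [hc, card_range_sdiff_pair (by omega) (by omega) (by omega)]))
  · rintro (rfl | rfl)
    · refine ⟨card_range_sdiff_pair (by omega) (by omega) (by omega), Or.inr (Or.inl ?_)⟩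
      simp
      omega
    · refine ⟨card_range_sdiff_pair (by omega) (by omega) (by omega), Or.inr (Or.inr ?_)⟩
      simp
      omega

/-- Every set between `{0, 2}` and the complement of `{1, 3}` is a cut. -/
theorem exists_isCut {n s : ℕ} (hn : 6 ≤ n) (h₁ : 2 ≤ s) (h₂ : s ≤ n - 2) :
    ∃ S : Finset ℕ, (∀ i ∈ S, i < n) ∧ S.card = s ∧ IsCut n S := by
  obtain ⟨S, h, hS, hc⟩ := Finset.exists_subsuperset_card_eq
    (show ({0, 2} : Finset ℕ) ⊆ Finset.range n \ {1, 3} by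
      intro x hx
      simp only [Finset.mem_insert, Finset.mem_singleton] at hx
      simp only [Finset.mem_sdiff, Finset.mem_range, Finset.mem_insert, Finset.mem_singleton]
      omega)
    (show _ ≤ s by simpa using h₁)
    (by rwa [card_range_sdiff_pair (by omega) (by omega) (by omega)])
  refine ⟨S, fun i hi => Finset.mem_range.1 (Finset.mem_sdiff.1 (hS hi)).1, hc,
    Or.inr (Or.inl ⟨h (by simp), fun h1 => ?_, h (by simp), fun h3 => ?_⟩)⟩
  · simpa using hS h1
  · simpa using hS h3

/-! ### Transfer back to `graphH n` and conclusion. -/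

theorem map_position_lt {n : ℕ} (hn : 6 ≤ n) {W : Finset (Fin n)} :
    ∀ i ∈ W.map (position n hn), i < n := by
  intro i hi
  obtain ⟨v, -, rfl⟩ := Finset.mem_map.1 hi
  exact position_lt n hn v

theorem exists_map_position_eq {n : ℕ} (hn : 6 ≤ n) {S : Finset ℕ} (hS : ∀ i ∈ S, i < n) :
    ∃ W : Finset (Fin n), W.map (position n hn) = S := by
  refine ⟨Finset.univ.filter fun v => position n hn v ∈ S, ?_⟩
  ext i
  constructor
  · intro hi
    obtain ⟨v, hv, rfl⟩ := Finset.mem_map.1 hi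
    exact (Finset.mem_filter.1 hv).2
  · intro hi
    obtain ⟨v, rfl⟩ := exists_position_eq n hn (hS i hi)
    exact Finset.mem_map_of_mem _ (Finset.mem_filter.2 ⟨Finset.mem_univ v, hi⟩)

theorem HS_graphH (𝕜 : Type*) [Field 𝕜] {n : ℕ} (hn : 6 ≤ n) (k : ℕ) :
    HS k (edgeIdeal 𝕜 (graphH n)ᶜ) = Ideal.span ((fun W => monomial (expo W) (1 : 𝕜)) ''
      {W | W.card = k + 2 ∧ IsCut n (W.map (position n hn))}) := by
  rw [HS_edgeIdeal_compl (graphH n) (fun v => eliminationRank n (position n hn v))]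
  · congr 3
    ext W
    rw [graphH_eq_comap n hn, isSeparated_comap, isSeparated_apexGraph hn (map_position_lt hn)]
  · rw [graphH_eq_comap n hn]
    intro v u w h₁ h₂ hu hw huw
    exact apexGraph_elimination hn (position_lt n hn v) (position_lt n hn u) (position_lt n hn w)
      h₁ h₂ hu hw ((position n hn).injective.ne huw)

theorem HS_graphH_ne_bot (𝕜 : Type*) [Field 𝕜] {n k : ℕ} (hn : 6 ≤ n) (hk : k ≤ n - 4) :
    HS k (edgeIdeal 𝕜 (graphH n)ᶜ) ≠ ⊥ := by
  obtain ⟨S, hS, hc, hcut⟩ := exists_isCut (s := k + 2) hn (by omega) (by omega)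
  obtain ⟨W, rfl⟩ := exists_map_position_eq hn hS
  rw [HS_graphH 𝕜 hn, Ne, Ideal.span_eq_bot]
  intro h
  have := h _ ⟨W, ⟨by rwa [Finset.card_map] at hc, hcut⟩, rfl⟩
  rw [monomial_eq_zero] at this
  exact one_ne_zero this

theorem HS_graphH_eq_bot (𝕜 : Type*) [Field 𝕜] {n k : ℕ} (hn : 6 ≤ n) (hk : n - 4 < k) :
    HS k (edgeIdeal 𝕜 (graphH n)ᶜ) = ⊥ := by
  rw [HS_graphH 𝕜 hn, Ideal.span_eq_bot]
  rintro _ ⟨W, ⟨hc, hcut⟩, -⟩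
  have := hcut.card_le hn (map_position_lt hn)
  rw [Finset.card_map] at this
  omega

theorem hasLinearQuotients_HS_graphH (𝕜 : Type*) [Field 𝕜] {n k : ℕ} (hn : 6 ≤ n)
    (hk : k < n - 4) : HasLinearQuotients (HS k (edgeIdeal 𝕜 (graphH n)ᶜ)) := by
  classical
  let D : Finset (Finset (Fin n)) :=
    Finset.univ.filter fun W => W.card = k + 2 ∧ IsCut n (W.map (position n hn))
  have hD : (D : Set (Finset (Fin n))) =
      {W | W.card = k + 2 ∧ IsCut n (W.map (position n hn))} := by
    ext W
    simp [D]
  rw [HS_graphH 𝕜 hn, ← hD]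
  refine hasLinearQuotients_span_expo (d := k + 2) (fun W hW => (Finset.mem_filter.1 hW).2.1)
    (fun W => toColex (W.map (position n hn))) ?_ ?_
  · intro W W' h
    exact Finset.map_injective _ (toColex_inj.1 h)
  · intro W hW W' hW' hlt
    obtain ⟨-, hc, hcut⟩ := Finset.mem_filter.1 hW
    obtain ⟨-, hc', hcut'⟩ := Finset.mem_filter.1 hW'
    obtain ⟨S, hS, hSc, hSlt, t, ht, ht', hsub⟩ := hcut.exists_exchange hn hcut'
      (map_position_lt hn) (by rw [Finset.card_map, Finset.card_map, hc, hc'])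
      (by rw [Finset.card_map]; omega) hlt
    obtain ⟨t, htW', rfl⟩ := Finset.mem_map.1 ht
    rw [← Finset.map_insert] at hsub
    obtain ⟨W'', rfl⟩ := exists_map_position_eq hn
      fun i hi => map_position_lt hn i (hsub hi)
    rw [Finset.card_map, Finset.card_map] at hSc
    exact ⟨W'', Finset.mem_filter.2 ⟨Finset.mem_univ _, hSc.trans hc, hS⟩, hSlt, t, htW',
      fun h => ht' (Finset.mem_map_of_mem _ h), Finset.map_subset_map.1 hsub⟩

theorem not_hasLinearQuotients_HS_graphH (𝕜 : Type*) [Field 𝕜] {n : ℕ} (hn : 6 ≤ n) :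
    ¬ HasLinearQuotients (HS (n - 4) (edgeIdeal 𝕜 (graphH n)ᶜ)) := by
  obtain ⟨U, hU⟩ := exists_map_position_eq hn (S := Finset.range n \ {1, 3})
    fun i hi => Finset.mem_range.1 (Finset.mem_sdiff.1 hi).1
  obtain ⟨W, hW⟩ := exists_map_position_eq hn (S := Finset.range n \ {0, n - 2})
    fun i hi => Finset.mem_range.1 (Finset.mem_sdiff.1 hi).1
  have hD : {W : Finset (Fin n) | W.card = n - 4 + 2 ∧ IsCut n (W.map (position n hn))} =
      {U, W} := by
    ext V
    have h := isCut_card_eq_iff hn (map_position_lt hn (W := V))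
    rw [Finset.card_map, ← hU, ← hW, Finset.map_inj, Finset.map_inj] at h
    rw [Set.mem_ofPred_eq, show n - 4 + 2 = n - 2 by omega]
    exact h
  -- The omitted pairs are disjoint, so each set contains two vertices that the other misses, and
  -- one insertion cannot supply both.
  have hsub : ∀ {a b c d : ℕ} {U W : Finset (Fin n)}, a < n → b < n → a ≠ b → a ≠ c → a ≠ d →
      b ≠ c → b ≠ d → U.map (position n hn) = Finset.range n \ {c, d} →
      W.map (position n hn) = Finset.range n \ {a, b} → ∀ t, ¬ U ⊆ insert t W := by
    intro a b c d U W ha hb hab hac had hbc hbd hU hW t h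
    rw [← Finset.map_subset_map (f := position n hn), Finset.map_insert, hU, hW] at h
    have h1 := h (show a ∈ _ by simp [ha, hac, had])
    have h2 := h (show b ∈ _ by simp [hb, hbc, hbd])
    simp at h1 h2
    omega
  have h₁ : ∀ t, ¬ U ⊆ insert t W := hsub (a := 0) (b := n - 2) (c := 1) (d := 3) (by omega)
    (by omega) (by omega) (by omega) (by omega) (by omega) (by omega) hU hW
  have h₂ : ∀ t, ¬ W ⊆ insert t U := hsub (a := 1) (b := 3) (c := 0) (d := n - 2) (by omega)
    (by omega) (by omega) (by omega) (by omega) (by omega) (by omega) hW hU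
  rw [HS_graphH 𝕜 hn, hD]
  refine not_hasLinearQuotients_pair ?_ ?_ h₁ h₂
  · rintro rfl
    exact h₁ ⟨0, by omega⟩ (Finset.subset_insert _ _)
  · rw [← Finset.card_map (position n hn), ← Finset.card_map (s := W) (position n hn), hU, hW,
      card_range_sdiff_pair (by omega) (by omega) (by omega),
      card_range_sdiff_pair (by omega) (by omega) (by omega)]

end HomShift

theorem theorem4p13 (𝕜 : Type*) [Field 𝕜] (n : ℕ) (hn : 6 ≤ n) :
    (∀ k : ℕ, 2 ≤ k → k < n - 4 →
      HomShift.HS k (HomShift.edgeIdeal 𝕜 (HomShift.graphH n)ᶜ) ≠ ⊥ ∧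
      HomShift.HasLinearQuotients (HomShift.HS k (HomShift.edgeIdeal 𝕜 (HomShift.graphH n)ᶜ))) ∧
    (HomShift.HS (n - 4) (HomShift.edgeIdeal 𝕜 (HomShift.graphH n)ᶜ) ≠ ⊥ ∧
      ¬ HomShift.HasLinearQuotients
        (HomShift.HS (n - 4) (HomShift.edgeIdeal 𝕜 (HomShift.graphH n)ᶜ))) ∧
    (∀ k : ℕ, n - 4 < k →
      HomShift.HS k (HomShift.edgeIdeal 𝕜 (HomShift.graphH n)ᶜ) = ⊥) :=
  ⟨fun _ _ hk => ⟨HomShift.HS_graphH_ne_bot 𝕜 hn hk.le,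
      HomShift.hasLinearQuotients_HS_graphH 𝕜 hn hk⟩,
    ⟨HomShift.HS_graphH_ne_bot 𝕜 hn le_rfl, HomShift.not_hasLinearQuotients_HS_graphH 𝕜 hn⟩,
    fun _ hk => HomShift.HS_graphH_eq_bot 𝕜 hn hk⟩
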